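/- Let $\mathbb{T}=\mathbb{R}/2\pi\mathbb{Z}$, $(\mathcal{F}\varphi)(k)=\frac1{2\pi}\int_{\mathbb{T}}e^{-ikx}\varphi(x)\,dx$ and $\sigma_t(k)=\sqrt{\cosh 2kt}$. For $t>0$ let $\mathcal{H}^2_t$ be the space of $\psi\in L^2(\mathbb{T})$ with $\|\psi\|_{\mathcal{H}^2_t}:=\|\sigma_t\mathcal{F}\psi\|_{\ell^2(\mathbb{Z})}<\infty$, and let the hyperdistribution space $\mathcal{H}^2_{-t}$ be the completion of $L^2(\mathbb{T})$ in the norm $\|\varphi\|_{\mathcal{H}^2_{-t}}=\sup_{\|\psi\|_{\mathcal{H}^2_t}=1}\left|\frac1{2\pi}\int_{\mathbb{T}}\overline{\varphi}\,\psi\,dx\right|$. Let $M\in\mathbb{R}$, $A,D\ge 0$ and $\zeta>0$. There is a constant $C$, depending only on $M,A,D,\zeta$, such that the following holds for all $\kappa<1$, $\alpha>0$, $q\in[1,\infty)$ and all $f$, $h$ as follows. Map: $f:\mathbb{T}\to\mathbb{T}$ has a lift to a homeomorphism $\hat f:\mathbb{R}\to\mathbb{R}$ whose inverse extends to an analytic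 function $v$ on the closed strip $\mathbb{R}_\zeta=\mathbb{R}+i[-\zeta,\zeta]$; on $\mathbb{R}_\zeta$ one has $|v'|\le\kappa$, and some branch of $\log v'$ on $\mathbb{R}_\zeta$ is $\alpha$-Hölder with constant $D$, where $D\le\frac{\pi}{3}\zeta^{-\alpha}$. Density: $h:\mathbb{T}\to(0,\infty)$ is continuous and extends to an analytic $2\pi$-periodic function on $\{|\operatorname{Im}z|<\zeta\}$ with $M^{-1}\le|h(z)|\le M$ there, and $\|\sigma_\zeta\,\mathcal{F}[(\log h)']\|_{\ell^q(\mathbb{Z})}\le A$. Let $\mathcal{K}\varphi=\varphi\circ f$ be the Koopman operator and, for $K\in\mathbb{N}$, let $\mathcal{P}_K$ be the orthogonal projection in $L^2(\mu)$, $\mu=h\,dx$, onto $\operatorname{span}\{e^{ikx}:|k|<K\}$. Then for every $t\in(0,\zeta]$, $\mathcal{K}$ and all $\mathcal{P}_K$ extend from $L^2(\mathbb{T})$ to bounded operators on $\mathcal{H}^2_{-t}$ and on $\mathcal{H}^2_{-\kappa t}$, the operator $\mathcal{K}$ is compact on $\mathcal{H}^2_{-t}$, and for all $K\in\mathbb{N}$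 \[ \|\mathcal{P}_K\mathcal{K}-\mathcal{K}\|_{\mathcal{H}^2_{-t}\to\mathcal{H}^2_{-t}}\le Ce^{-(1-\kappa)tK},\qquad \|\mathcal{K}\mathcal{P}_K-\mathcal{K}\|_{\mathcal{H}^2_{-\kappa t}\to\mathcal{H}^2_{-\kappa t}}\le Ce^{-(1-\kappa)tK}. \] -/

import Mathlib

open MeasureTheory Complex
open scoped ENNReal NNReal Real ComplexConjugate

noncomputable section

namespace EDMD

instance factTwoPiPos : Fact (0 < 2 * π) := ⟨Real.two_pi_pos⟩

/-- The torus `ℝ / 2πℤ`. -/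
abbrev Torus : Type := AddCircle (2 * π)

/-- `L²` of the torus, with respect to normalised Lebesgue measure `dx / 2π`. -/
abbrev TorusL2 : Type := Lp ℂ 2 (AddCircle.haarAddCircle : Measure Torus)

/-! ### Weighted Fourier norms and the hyperdistribution spaces -/

/-- The weighted Fourier norm `‖σ · 𝓕 g‖` in `ℓ^q(ℤ)` (possibly infinite), where
`(𝓕 g)(k) = (1 / 2π) ∫ exp(-ikx) g(x) dx`. The norm of `W^σ` is the case `q = 2`. -/
def weightedNorm (σ : ℤ → ℝ) (q : ℝ≥0∞) (g : Torus → ℂ) : ℝ≥0∞ :=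
  eLpNorm (fun k : ℤ => (σ k : ℂ) * fourierCoeff g k) q Measure.count

/-- The weight `σ_t(k) = √(cosh 2kt)`, for which `W^σ` is the Hardy space `H²_t` of the strip
`|Im z| < t`. -/
def hardyWeight (t : ℝ) (k : ℤ) : ℝ := √(Real.cosh (2 * k * t))

lemma one_le_hardyWeight (t : ℝ) (k : ℤ) : 1 ≤ hardyWeight t k :=
  Real.one_le_sqrt.2 (Real.one_le_cosh _)

lemma norm_le_one_of_weightedNorm {t : ℝ} {ψ : TorusL2}
    (h : weightedNorm (hardyWeight t) 2 ψ = 1) : ‖ψ‖ ≤ 1 := by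
  have h1 : (∑' k : ℤ, ‖(hardyWeight t k : ℂ) * fourierCoeff ψ k‖ₑ ^ (2 : ℝ)) = 1 := by
    have h2 := eLpNorm_nnreal_pow_eq_lintegral (μ := (Measure.count : Measure ℤ))
      (f := fun k : ℤ => (hardyWeight t k : ℂ) * fourierCoeff ψ k) (p := 2) (by norm_num)
    rw [lintegral_count] at h2
    have h3 : eLpNorm (fun k : ℤ => (hardyWeight t k : ℂ) * fourierCoeff ψ k)
        ((2 : ℝ≥0) : ℝ≥0∞) Measure.count = 1 := by
      simpa [weightedNorm] using h
    rw [h3] at h2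
    simpa using h2.symm
  have h4 : HasSum (fun k : ℤ => ‖fourierCoeff ψ k‖ ^ 2) (‖ψ‖ ^ 2) := by
    have h5 := hasSum_sq_fourierCoeff ψ
    have h6 : ‖ψ‖ ^ 2 = ∫ x, ‖ψ x‖ ^ 2 ∂(AddCircle.haarAddCircle : Measure Torus) := by
      have h7 : ((‖ψ‖ ^ 2 : ℝ) : ℂ) = inner ℂ ψ ψ := by
        rw [inner_self_eq_norm_sq_to_K]; simp
      rw [L2.inner_def] at h7
      have h8 : ∀ x, inner ℂ (ψ x) (ψ x) = ((‖ψ x‖ ^ 2 : ℝ) : ℂ) := by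
        intro x
        rw [inner_self_eq_norm_sq_to_K]; simp
      simp only [h8] at h7
      rw [integral_complex_ofReal] at h7
      exact_mod_cast h7
    rw [h6]; exact h5
  have h9 : ENNReal.ofReal (‖ψ‖ ^ 2) ≤ 1 := by
    rw [← h4.tsum_eq, ENNReal.ofReal_tsum_of_nonneg (fun k => by positivity) h4.summable, ← h1]
    refine ENNReal.tsum_le_tsum fun k => ?_
    rw [← ofReal_norm, ENNReal.ofReal_rpow_of_nonneg (norm_nonneg _) (by norm_num)]
    refine ENNReal.ofReal_le_ofReal ?_
    rw [norm_mul, Complex.norm_real, Real.rpow_two, Real.norm_eq_abs]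
    have h10 := (one_le_hardyWeight t k).trans (le_abs_self _)
    gcongr
    exact le_mul_of_one_le_left (norm_nonneg _) h10
  have h11 : ‖ψ‖ ^ 2 ≤ 1 := by rwa [ENNReal.ofReal_le_one] at h9
  nlinarith [norm_nonneg ψ]

/-- The pairings of `φ` with the unit sphere of `W^σ`, `σ = hardyWeight t`, are bounded. -/
lemma bddAbove_pairing (t : ℝ) (φ : TorusL2) :
    BddAbove (Set.range fun ψ : {ψ : TorusL2 // weightedNorm (hardyWeight t) 2 ψ = 1} =>
      ‖inner ℂ φ ψ.1‖) := by
  refine ⟨‖φ‖, ?_⟩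
  rintro _ ⟨ψ, rfl⟩
  exact (norm_inner_le_norm φ ψ.1).trans
    (mul_le_of_le_one_right (norm_nonneg _) (norm_le_one_of_weightedNorm ψ.2))

/-- The dual norm `φ ↦ sup |(1 / 2π) ∫ conj φ · ψ dx|` on `L²`, the supremum being over the `ψ`
with `‖ψ‖ = 1` in `H²_t`. -/
def dualNorm (t : ℝ) : Seminorm ℂ TorusL2 :=
  Seminorm.of
    (fun φ => ⨆ ψ : {ψ : TorusL2 // weightedNorm (hardyWeight t) 2 ψ = 1}, ‖inner ℂ φ ψ.1‖)
    (fun φ₁ φ₂ => Real.iSup_le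
      (fun ψ => by
        rw [inner_add_left]
        exact (norm_add_le _ _).trans
          (add_le_add (le_ciSup (bddAbove_pairing t φ₁) ψ) (le_ciSup (bddAbove_pairing t φ₂) ψ)))
      (add_nonneg (Real.iSup_nonneg fun _ => norm_nonneg _)
        (Real.iSup_nonneg fun _ => norm_nonneg _)))
    (fun c φ => by
      simp only [inner_smul_left, norm_mul, RCLike.norm_conj]
      exact (Real.mul_iSup_of_nonneg (norm_nonneg c) _).symm)

/-- `L²` of the torus, equipped with the dual norm of `H²_t` instead of its own norm. -/
def PreHyper (_t : ℝ) : Type := TorusL2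

instance (t : ℝ) : AddCommGroup (PreHyper t) := inferInstanceAs (AddCommGroup TorusL2)

instance (t : ℝ) : Module ℂ (PreHyper t) := inferInstanceAs (Module ℂ TorusL2)

instance (t : ℝ) : SeminormedAddCommGroup (PreHyper t) :=
  AddGroupSeminorm.toSeminormedAddCommGroup (E := PreHyper t) (dualNorm t).toAddGroupSeminorm

instance (t : ℝ) : NormedSpace ℂ (PreHyper t) where
  norm_smul_le c φ := (map_smul_eq_mul (dualNorm t) c φ).le

/-- The hyperdistribution space `H²_{-t}`: the completion of `L²` in the dual norm of `H²_t`. -/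
abbrev Hyper (t : ℝ) : Type := UniformSpace.Completion (PreHyper t)

/-- The inclusion of `L²` in `H²_{-t}`. -/
def toHyper (t : ℝ) (φ : TorusL2) : Hyper t := ((show PreHyper t from φ : PreHyper t) : Hyper t)

/-- The bounded operator `B` on `H²_{-t}` extends the operator `T`, given on functions; part of
this is that `T` maps `L²` to `L²`. -/
def Extends (t : ℝ) (B : Hyper t →L[ℂ] Hyper t) (T : (Torus → ℂ) → (Torus → ℂ)) : Prop :=
  ∀ (φ : Torus → ℂ) (hφ : MemLp φ 2 (AddCircle.haarAddCircle : Measure Torus)),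
    ∃ hT : MemLp (T φ) 2 (AddCircle.haarAddCircle : Measure Torus),
      B (toHyper t (hφ.toLp φ)) = toHyper t (hT.toLp (T φ))

/-! ### The Koopman operator and the projection onto trigonometric polynomials -/

/-- The Koopman operator `φ ↦ φ ∘ f`. -/
def koopman (f : Torus → Torus) (φ : Torus → ℂ) : Torus → ℂ := fun x => φ (f x)

/-- The sampling measure `μ = h dx`. -/
def samplingMeasure (h : C(Torus, ℝ)) : Measure Torus :=
  (volume : Measure Torus).withDensity fun x => ENNReal.ofReal (h x)

instance (h : C(Torus, ℝ)) : IsFiniteMeasure (samplingMeasure h) := by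
  refine isFiniteMeasure_withDensity (ne_of_lt ?_)
  calc ∫⁻ x, ENNReal.ofReal (h x) ∂(volume : Measure Torus)
      ≤ ∫⁻ _, ENNReal.ofReal ‖h‖ ∂(volume : Measure Torus) :=
        lintegral_mono fun x =>
          ENNReal.ofReal_le_ofReal ((le_abs_self _).trans (h.norm_coe_le_norm x))
    _ < ∞ := by
        rw [lintegral_const]
        exact ENNReal.mul_lt_top ENNReal.ofReal_lt_top (measure_lt_top _ _)

/-- The trigonometric polynomials of degree less than `K`, that is the span of the
`x ↦ exp(ikx)` with `|k| < K`, in `L²(μ)`. -/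
def trigPoly (μ : Measure Torus) [IsFiniteMeasure μ] (K : ℕ) : Submodule ℂ (Lp ℂ 2 μ) :=
  Submodule.span ℂ
    ((fun k : ℤ => ContinuousMap.toLp (E := ℂ) 2 μ ℂ (fourier k)) '' {k : ℤ | |k| < (K : ℤ)})

instance (μ : Measure Torus) [IsFiniteMeasure μ] (K : ℕ) :
    FiniteDimensional ℂ (trigPoly μ K) := by
  refine FiniteDimensional.span_of_finite ℂ (Set.Finite.image _ ?_)
  exact (Set.finite_Ioo (-(K : ℤ)) K).subset fun k hk => abs_lt.1 hk

open Classical in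
/-- The orthogonal projection in `L²(μ)` onto trigonometric polynomials of degree less than `K`
(the value outside `L²(μ)` is irrelevant). -/
def trigProj (μ : Measure Torus) [IsFiniteMeasure μ] (K : ℕ) (φ : Torus → ℂ) : Torus → ℂ :=
  if hφ : MemLp φ 2 μ then ⇑((trigPoly μ K).starProjection (hφ.toLp φ)) else 0

/-! ### Assumptions on the map and on the density -/

/-- The closed strip `ℝ + i[-ζ, ζ]`. -/
def closedStrip (ζ : ℝ) : Set ℂ := {z | |z.im| ≤ ζ}

/-- The open strip `ℝ + i(-ζ, ζ)`. -/
def openStrip (ζ : ℝ) : Set ℂ := {z | |z.im| < ζ}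

/-- The quantitative assumption that `f` is an analytic, uniformly expanding circle map: the
inverse of a lift of `f` extends to an analytic function `v` on the closed strip of half-width
`ζ`, there `|v'| ≤ κ < 1`, and a branch `ℓ` of `log v'` has `α`-Hölder constant at most `D`, where
`D ≤ (π / 3) ζ ^ (-α)`. (As `v'` is negative on `ℝ` for an orientation-reversing `f`, the branch
need not be the principal one.) -/
structure IsExpanding (f : Torus → Torus) (ζ κ : ℝ) (α D : ℝ≥0) : Prop where
  kappa_lt_one : κ < 1
  alpha_pos : 0 < α
  D_le : (D : ℝ) ≤ π / 3 * ζ ^ (-(α : ℝ))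
  exists_inverse_lift : ∃ (fhat : ℝ ≃ₜ ℝ) (v : ℂ → ℂ),
    (∀ x : ℝ, ((fhat x : ℝ) : Torus) = f (x : Torus)) ∧
    (∀ y : ℝ, v (y : ℂ) = ((fhat.symm y : ℝ) : ℂ)) ∧
    AnalyticOnNhd ℂ v (closedStrip ζ) ∧
    (∀ z ∈ closedStrip ζ, ‖deriv v z‖ ≤ κ) ∧
    ∃ ℓ : ℂ → ℂ, (∀ z ∈ closedStrip ζ, Complex.exp (ℓ z) = deriv v z) ∧
      HolderOnWith D α ℓ (closedStrip ζ)

/-- The derivative of a function on the torus. -/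
def torusDeriv (g : Torus → ℝ) (θ : Torus) : ℝ := deriv (fun y : ℝ => g (θ + (y : Torus))) 0

/-- The quantitative assumption on the density `h` of the sampling measure: it is positive, has
an analytic extension `H` to the open strip of half-width `ζ` modulo `2π`, with
`M⁻¹ ≤ |H| ≤ M`, and `‖σ · 𝓕[(log h)']‖ ≤ A` in `ℓ^q`, where `σ = hardyWeight ζ`. -/
structure IsAnalyticDensity (h : C(Torus, ℝ)) (ζ M : ℝ) (A : ℝ≥0) (q : ℝ≥0∞) : Prop where
  pos : ∀ θ, 0 < h θ
  exists_extension : ∃ H : ℂ → ℂ,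
    DifferentiableOn ℂ H (openStrip ζ) ∧
    (∀ z, H (z + 2 * π) = H z) ∧
    (∀ x : ℝ, H (x : ℂ) = (h (x : Torus) : ℂ)) ∧
    ∀ z ∈ openStrip ζ, M⁻¹ ≤ ‖H z‖ ∧ ‖H z‖ ≤ M
  one_le_q : 1 ≤ q
  q_ne_top : q ≠ ∞
  log_deriv_le :
    weightedNorm (hardyWeight ζ) q
      (fun θ => ((torusDeriv (fun x => Real.log (h x)) θ : ℝ) : ℂ)) ≤ A

end EDMD

end

open EDMD

namespace EDMD

/-! ### Fourier coefficients and the dual norm -/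

/-! The Koopman operator maps `H²_{-t}` boundedly into the smaller space `H²_{-κt}`, and `P_K - 1`
maps `H²_{-κt}` into `H²_{-t}` with norm `O(exp(-(1-κ)tK))`. Composing these two facts in either
order gives the two estimates, and the first estimate makes `𝒦` a norm limit of finite-rank
operators, hence compact.

Smoothing (`IsExpanding.dualNorm_koopman_le`). By duality and a change of variables one has to bound
`∫ conj φ(y) v'(y) ψ(v y) dy` over a period of `v`, for trigonometric polynomials. If the
frequencies of `φ` have one sign, `conj φ` extends holomorphically and its modes shrink to
`exp(-|k|t)` on one of the lines `Im z = ±t`; the contour is moved there. This line is sent by `v`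
into `|Im z| ≤ κt`, and on it `|v'|` is at most `exp(π/3)` times its value on the real line. The
factor in `φ` is then controlled by the bounded distortion of `v'`. For the factor `ψ ∘ v` with `ψ`
one-sided, `|ψ|²` is dominated by the real part of a polynomial in `exp(±iz)`, which stays
nonnegative harmonic after composition with `v`. In the integral against `|v'|` the vertical shift
can be moved from this function onto `v'` (`InverseLift.integral_weight_mul_re_le`), and on the real
line only the constant coefficient survives. No constant depends on the degree of `f`.

Projection (`IsAnalyticDensity.dualNorm_projection_sub_le`). Self-adjointness of `P` in `L²(μ)`
turns the pairing of `(P - 1)φ` with `ψ` into that of `φ` with `h(P - 1)(ψ/h)`. Multiplication by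
`h` and `1/h` is bounded on Hardy spaces, and `P - 1` sees only the Fourier tail of `ψ/h`. The tail
is small in the weaker Hardy norm, and its image under `P` is handled by an `L²` bound and an
inverse inequality. -/

lemma inner_fourierLp (k : ℤ) (φ : TorusL2) :
    inner ℂ (fourierLp 2 k : TorusL2) φ = fourierCoeff φ k := by
  rw [← fourierBasis_repr, HilbertBasis.repr_apply_apply, coe_fourierBasis]

lemma fourierCoeff_sub_L2 (φ ψ : TorusL2) (k : ℤ) :
    fourierCoeff (φ - ψ : TorusL2) k = fourierCoeff φ k - fourierCoeff ψ k := by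
  simp only [← inner_fourierLp, inner_sub_right]

lemma fourierCoeff_smul_L2 (c : ℂ) (φ : TorusL2) (k : ℤ) :
    fourierCoeff (c • φ : TorusL2) k = c * fourierCoeff φ k := by
  simp only [← inner_fourierLp, inner_smul_right]

/-- The trigonometric polynomial with coefficients `c` on `F`. -/
noncomputable def trigSum (F : Finset ℤ) (c : ℤ → ℂ) : TorusL2 := ∑ k ∈ F, c k • (fourierLp 2 k : TorusL2)

lemma fourierCoeff_fourierLp (j k : ℤ) :
    fourierCoeff (fourierLp 2 j : TorusL2) k = if k = j then 1 else 0 := by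
  rw [← inner_fourierLp]
  exact orthonormal_iff_ite.1 orthonormal_fourier k j

lemma fourierCoeff_trigSum (F : Finset ℤ) (c : ℤ → ℂ) (k : ℤ) :
    fourierCoeff (trigSum F c) k = if k ∈ F then c k else 0 := by
  rw [← inner_fourierLp, trigSum, inner_sum]
  simp only [inner_smul_right, inner_fourierLp, fourierCoeff_fourierLp]
  simp

lemma inner_trigSum (φ : TorusL2) (F : Finset ℤ) (c : ℤ → ℂ) :
    inner ℂ φ (trigSum F c) = ∑ k ∈ F, conj (fourierCoeff φ k) * c k := by
  rw [trigSum, inner_sum]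
  refine Finset.sum_congr rfl fun k _ => ?_
  rw [inner_smul_right, ← inner_conj_symm, inner_fourierLp, mul_comm]

lemma tendsto_trigSum (φ : TorusL2) :
    Filter.Tendsto (fun F => trigSum F (fourierCoeff φ)) Filter.atTop (nhds φ) :=
  hasSum_fourier_series_L2 φ

lemma hasSum_norm_sq (φ : TorusL2) : HasSum (fun k => ‖fourierCoeff φ k‖ ^ 2) (‖φ‖ ^ 2) := by
  have h5 := hasSum_sq_fourierCoeff φ
  have h6 : ‖φ‖ ^ 2 = ∫ x, ‖φ x‖ ^ 2 ∂(AddCircle.haarAddCircle : Measure Torus) := by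
    have h7 : ((‖φ‖ ^ 2 : ℝ) : ℂ) = inner ℂ φ φ := by
      rw [inner_self_eq_norm_sq_to_K]; simp
    rw [L2.inner_def] at h7
    have h8 : ∀ x, inner ℂ (φ x) (φ x) = ((‖φ x‖ ^ 2 : ℝ) : ℂ) := by
      intro x
      rw [inner_self_eq_norm_sq_to_K]; simp
    simp only [h8] at h7
    rw [integral_complex_ofReal] at h7
    exact_mod_cast h7
  rw [h6]; exact h5

/-- `ψ` lies in the ball of radius `B` of `H²_t`. -/
def HardyBound (t : ℝ) (ψ : TorusL2) (B : ℝ) : Prop :=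
  ∀ F : Finset ℤ, ∑ k ∈ F, Real.cosh (2 * k * t) * ‖fourierCoeff ψ k‖ ^ 2 ≤ B ^ 2

lemma weightedNorm_sq (t : ℝ) (ψ : TorusL2) :
    weightedNorm (hardyWeight t) 2 ψ ^ (2 : ℝ) =
      ∑' k : ℤ, ENNReal.ofReal (Real.cosh (2 * k * t) * ‖fourierCoeff ψ k‖ ^ 2) := by
  have h2 := eLpNorm_nnreal_pow_eq_lintegral (μ := (Measure.count : Measure ℤ))
    (f := fun k : ℤ => (hardyWeight t k : ℂ) * fourierCoeff ψ k) (p := 2) (by norm_num)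
  rw [lintegral_count] at h2
  have h3 : weightedNorm (hardyWeight t) 2 ψ ^ (2 : ℝ) =
      ∑' k : ℤ, ‖(hardyWeight t k : ℂ) * fourierCoeff ψ k‖ₑ ^ (2 : ℝ) := by
    simpa [weightedNorm] using h2
  rw [h3]
  refine tsum_congr fun k => ?_
  rw [← ofReal_norm, ENNReal.ofReal_rpow_of_nonneg (norm_nonneg _) (by norm_num), norm_mul,
    Complex.norm_real, Real.rpow_two, mul_pow, Real.norm_eq_abs, sq_abs, hardyWeight,
    Real.sq_sqrt (Real.cosh_pos _).le]

lemma weightedNorm_eq_one {t : ℝ} {ψ : TorusL2} :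
    weightedNorm (hardyWeight t) 2 ψ = 1 ↔
      HasSum (fun k : ℤ => Real.cosh (2 * k * t) * ‖fourierCoeff ψ k‖ ^ 2) 1 := by
  have hn : ∀ k : ℤ, 0 ≤ Real.cosh (2 * k * t) * ‖fourierCoeff ψ k‖ ^ 2 := fun k =>
    mul_nonneg (Real.cosh_pos _).le (sq_nonneg _)
  have h1 : weightedNorm (hardyWeight t) 2 ψ = 1 ↔
      weightedNorm (hardyWeight t) 2 ψ ^ (2 : ℝ) = 1 := by
    constructor
    · intro h; rw [h]; simp
    · intro h
      rw [← ENNReal.rpow_rpow_inv two_ne_zero (weightedNorm (hardyWeight t) 2 ψ), h,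
        ENNReal.one_rpow]
  rw [h1, weightedNorm_sq]
  constructor
  · intro h
    have hs : Summable fun k : ℤ => Real.cosh (2 * k * t) * ‖fourierCoeff ψ k‖ ^ 2 := by
      have := ENNReal.summable_toReal (h.trans_ne ENNReal.one_ne_top)
      simpa only [ENNReal.toReal_ofReal (hn _)] using this
    rw [← ENNReal.ofReal_tsum_of_nonneg hn hs, ENNReal.ofReal_eq_one] at h
    exact h ▸ hs.hasSum
  · intro h
    rw [← ENNReal.ofReal_tsum_of_nonneg hn h.summable, h.tsum_eq, ENNReal.ofReal_one]

lemma dualNorm_apply (t : ℝ) (φ : TorusL2) :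
    dualNorm t φ =
      ⨆ ψ : {ψ : TorusL2 // weightedNorm (hardyWeight t) 2 ψ = 1}, ‖inner ℂ φ ψ.1‖ := rfl

/-- The dual norm tests unit vectors only, so a nonzero `ψ` is divided by its Hardy norm `√S`, which
is positive because it dominates the `L²` norm. -/
lemma HardyBound.norm_inner_le {t B : ℝ} {ψ : TorusL2} (h : HardyBound t ψ B) (hB : 0 ≤ B)
    (φ : TorusL2) : ‖inner ℂ φ ψ‖ ≤ B * dualNorm t φ := by
  by_cases h0 : ψ = 0
  · rw [h0, inner_zero_right, norm_zero]
    exact mul_nonneg hB (apply_nonneg _ _)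
  have hn : ∀ k : ℤ, 0 ≤ Real.cosh (2 * k * t) * ‖fourierCoeff ψ k‖ ^ 2 := fun k =>
    mul_nonneg (Real.cosh_pos _).le (sq_nonneg _)
  have hs := summable_of_sum_le hn h
  set S := ∑' k : ℤ, Real.cosh (2 * k * t) * ‖fourierCoeff ψ k‖ ^ 2 with hS
  have hSB : S ≤ B ^ 2 := hs.tsum_le_of_sum_le h
  have hpos : 0 < S := by
    have h1 : ‖ψ‖ ^ 2 ≤ S := by
      rw [← (hasSum_norm_sq ψ).tsum_eq]
      refine (hasSum_norm_sq ψ).summable.tsum_le_tsum (fun k => ?_) hs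
      exact le_mul_of_one_le_left (sq_nonneg _) (Real.one_le_cosh _)
    exact (pow_pos (norm_pos_iff.2 h0) 2).trans_le h1
  have hr : 0 < √S := Real.sqrt_pos.2 hpos
  have h1 : weightedNorm (hardyWeight t) 2 (((√S)⁻¹ : ℂ) • ψ : TorusL2) = 1 := by
    rw [weightedNorm_eq_one]
    have h2 := hs.hasSum.mul_left S⁻¹
    rw [← hS, inv_mul_cancel₀ hpos.ne'] at h2
    convert! h2 using 2 with k
    rw [fourierCoeff_smul_L2, norm_mul, norm_inv, Complex.norm_real, Real.norm_eq_abs,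
      abs_of_pos hr, mul_pow, inv_pow, Real.sq_sqrt hpos.le]
    ring
  have h2 : ‖inner ℂ φ (((√S)⁻¹ : ℂ) • ψ : TorusL2)‖ ≤ dualNorm t φ :=
    le_ciSup (bddAbove_pairing t φ) ⟨_, h1⟩
  rw [inner_smul_right, norm_mul, norm_inv, Complex.norm_real, Real.norm_eq_abs,
    abs_of_pos hr, inv_mul_le_iff₀ hr] at h2
  refine h2.trans (mul_le_mul_of_nonneg_right ?_ (apply_nonneg _ _))
  exact Real.sqrt_le_iff.2 ⟨hB, hSB⟩

lemma hardyBound_trigSum {t B : ℝ} {F : Finset ℤ} {c : ℤ → ℂ}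
    (h : ∑ k ∈ F, Real.cosh (2 * k * t) * ‖c k‖ ^ 2 ≤ B ^ 2) : HardyBound t (trigSum F c) B := by
  intro F'
  refine le_trans ?_ h
  simp only [fourierCoeff_trigSum]
  calc _ = ∑ k ∈ F' ∩ F, Real.cosh (2 * k * t) * ‖c k‖ ^ 2 := by
        rw [← Finset.filter_mem_eq_inter, Finset.sum_filter]
        refine Finset.sum_congr rfl fun k _ => ?_
        split_ifs <;> simp
    _ ≤ _ := Finset.sum_le_sum_of_subset_of_nonneg Finset.inter_subset_right fun k _ _ =>
        mul_nonneg (Real.cosh_pos _).le (sq_nonneg _)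

lemma dualNorm_le {t C : ℝ} {φ : TorusL2} (hC : 0 ≤ C)
    (h : ∀ ψ, HardyBound t ψ 1 → ‖inner ℂ φ ψ‖ ≤ C) : dualNorm t φ ≤ C := by
  rw [dualNorm_apply]
  refine Real.iSup_le (fun ψ => h _ fun F => ?_) hC
  have h1 := weightedNorm_eq_one.1 ψ.2
  rw [one_pow]
  exact sum_le_hasSum F (fun k _ => mul_nonneg (Real.cosh_pos _).le (sq_nonneg _)) h1

/-- Fourier truncations converge in `L²` and do not increase the Hardy norm. -/
lemma dualNorm_le_of_trigSum {t C : ℝ} {φ : TorusL2} (hC : 0 ≤ C)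
    (h : ∀ (F : Finset ℤ) (c : ℤ → ℂ), ∑ k ∈ F, Real.cosh (2 * k * t) * ‖c k‖ ^ 2 ≤ 1 →
      ‖inner ℂ φ (trigSum F c)‖ ≤ C) : dualNorm t φ ≤ C := by
  refine dualNorm_le hC fun ψ hψ => ?_
  have h1 : Filter.Tendsto (fun F => inner ℂ φ (trigSum F (fourierCoeff ψ))) Filter.atTop
      (nhds (inner ℂ φ ψ)) := tendsto_const_nhds.inner (tendsto_trigSum ψ)
  refine le_of_tendsto h1.norm (Filter.Eventually.of_forall fun F => h _ _ ?_)
  simpa using hψ F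

/-- The extremal test function has coefficients `φ_k / cosh 2kt` on `F`: its Hardy norm is `√S` and
its pairing with `φ` is `S`. -/
lemma sum_div_cosh_le (t : ℝ) (φ : TorusL2) (F : Finset ℤ) :
    ∑ k ∈ F, ‖fourierCoeff φ k‖ ^ 2 / Real.cosh (2 * k * t) ≤ dualNorm t φ ^ 2 := by
  set S := ∑ k ∈ F, ‖fourierCoeff φ k‖ ^ 2 / Real.cosh (2 * k * t) with hS
  have hS0 : 0 ≤ S := Finset.sum_nonneg fun k _ => div_nonneg (sq_nonneg _) (Real.cosh_pos _).le
  have h1 : HardyBound t (trigSum F fun k => fourierCoeff φ k / (Real.cosh (2 * k * t) : ℝ))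
      (√S) := by
    refine hardyBound_trigSum (le_of_eq ?_)
    rw [Real.sq_sqrt hS0, hS]
    refine Finset.sum_congr rfl fun k _ => ?_
    have := Real.cosh_pos (2 * k * t)
    rw [norm_div, Complex.norm_real, Real.norm_eq_abs, abs_of_pos this]
    field_simp
  have h2 := h1.norm_inner_le (Real.sqrt_nonneg _) φ
  rw [inner_trigSum] at h2
  have h3 : ∑ k ∈ F, conj (fourierCoeff φ k) * (fourierCoeff φ k / (Real.cosh (2 * k * t) : ℝ))
      = (S : ℂ) := by
    rw [hS, Complex.ofReal_sum]
    refine Finset.sum_congr rfl fun k _ => ?_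
    rw [← mul_div_assoc, Complex.conj_mul', Complex.ofReal_div, Complex.ofReal_pow]
  rw [h3, Complex.norm_real, Real.norm_eq_abs, abs_of_nonneg hS0] at h2
  nlinarith [Real.sq_sqrt hS0, Real.sqrt_nonneg S, apply_nonneg (dualNorm t) φ]

lemma cosh_le_cosh_of_le {s t : ℝ} (hs : 0 ≤ s) (hst : s ≤ t) (k : ℤ) :
    Real.cosh (2 * k * s) ≤ Real.cosh (2 * k * t) := by
  rw [Real.cosh_le_cosh, abs_mul, abs_mul _ t, abs_of_nonneg hs, abs_of_nonneg (hs.trans hst)]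
  exact mul_le_mul_of_nonneg_left hst (abs_nonneg _)

lemma HardyBound.mono {s t B : ℝ} {ψ : TorusL2} (h : HardyBound t ψ B) (hs : 0 ≤ s)
    (hst : s ≤ t) : HardyBound s ψ B := fun F =>
  (Finset.sum_le_sum fun k _ => mul_le_mul_of_nonneg_right (cosh_le_cosh_of_le hs hst k)
    (sq_nonneg _)).trans (h F)

lemma dualNorm_antitone {s t : ℝ} (hs : 0 ≤ s) (hst : s ≤ t) (φ : TorusL2) :
    dualNorm t φ ≤ dualNorm s φ :=
  dualNorm_le (apply_nonneg _ _) fun ψ hψ => by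
    simpa using (hψ.mono hs hst).norm_inner_le zero_le_one φ

lemma HardyBound.norm_le {t B : ℝ} {ψ : TorusL2} (h : HardyBound t ψ B) (hB : 0 ≤ B) :
    ‖ψ‖ ≤ B := by
  have h1 : ‖ψ‖ ^ 2 ≤ B ^ 2 := by
    refine hasSum_le_of_sum_le (hasSum_norm_sq ψ) fun F => le_trans ?_ (h F)
    exact Finset.sum_le_sum fun k _ => le_mul_of_one_le_left (sq_nonneg _) (Real.one_le_cosh _)
  exact le_of_sq_le_sq h1 hB

/-! ### Operators on the hyperdistribution spaces -/

lemma denseRange_toHyper (t : ℝ) : DenseRange (toHyper t) :=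
  UniformSpace.Completion.denseRange_coe (α := PreHyper t)

lemma norm_toHyper (t : ℝ) (φ : TorusL2) : ‖toHyper t φ‖ = dualNorm t φ :=
  UniformSpace.Completion.norm_coe (E := PreHyper t) φ

lemma toHyper_sub (t : ℝ) (φ ψ : TorusL2) : toHyper t (φ - ψ) = toHyper t φ - toHyper t ψ :=
  UniformSpace.Completion.coe_sub (α := PreHyper t) φ ψ

/-- The bound makes `S` uniformly continuous for the norm that is being completed; continuity in the
`L²` norm plays no role. -/
lemma exists_hyper_extension {t C : ℝ} (S : TorusL2 →ₗ[ℂ] TorusL2)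
    (h : ∀ φ, dualNorm t (S φ) ≤ C * dualNorm t φ) :
    ∃ B : Hyper t →L[ℂ] Hyper t, ∀ φ, B (toHyper t φ) = toHyper t (S φ) := by
  let S' : PreHyper t →ₗ[ℂ] PreHyper t := S
  let S'' : PreHyper t →L[ℂ] PreHyper t := S'.mkContinuous C h
  exact ⟨S''.completion, fun φ => UniformSpace.Completion.map_coe S''.uniformContinuous φ⟩

lemma opNorm_le_of_dualNorm_le {t C : ℝ} (hC : 0 ≤ C) {B : Hyper t →L[ℂ] Hyper t}
    {S : TorusL2 → TorusL2} (hB : ∀ φ, B (toHyper t φ) = toHyper t (S φ))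
    (h : ∀ φ, dualNorm t (S φ) ≤ C * dualNorm t φ) : ‖B‖ ≤ C := by
  refine B.opNorm_le_bound hC fun x => ?_
  refine (denseRange_toHyper t).induction_on (p := fun x => ‖B x‖ ≤ C * ‖x‖) x
    (isClosed_le (by fun_prop) (by fun_prop)) fun φ => ?_
  rw [hB, norm_toHyper, norm_toHyper]
  exact h φ

/-! ### Trigonometric polynomials on horizontal lines -/

/-- The trigonometric polynomial with coefficients `c` on `F`, as an entire function. -/
noncomputable def trigFun (F : Finset ℤ) (c : ℤ → ℂ) (z : ℂ) : ℂ := ∑ k ∈ F, c k * exp (k * z * I)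

@[fun_prop]
lemma differentiable_trigFun (F : Finset ℤ) (c : ℤ → ℂ) : Differentiable ℂ (trigFun F c) := by
  unfold trigFun; fun_prop

lemma exp_int_mul_add_two_pi (k : ℤ) (z : ℂ) :
    exp (k * (z + 2 * π) * I) = exp (k * z * I) := by
  rw [show (k : ℂ) * (z + 2 * π) * I = k * z * I + k * (2 * π * I) by ring,
    exp_add, exp_int_mul_two_pi_mul_I, mul_one]

lemma trigFun_add_two_pi (F : Finset ℤ) (c : ℤ → ℂ) (z : ℂ) :
    trigFun F c (z + 2 * π) = trigFun F c z := by
  simp only [trigFun, exp_int_mul_add_two_pi]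

lemma integral_exp_int (k : ℤ) :
    ∫ x in (0 : ℝ)..2 * π, exp (k * x * I) = if k = 0 then (2 * π : ℂ) else 0 := by
  split_ifs with h
  · simp [h]
  · have hk : (k : ℂ) * I ≠ 0 := mul_ne_zero (Int.cast_ne_zero.2 h) I_ne_zero
    have h1 := integral_exp_mul_complex (a := 0) (b := 2 * π) hk
    simp only [mul_right_comm _ I] at h1
    rw [h1]
    have h2 := exp_int_mul_add_two_pi k 0
    simp at h2 ⊢
    left
    rw [sub_eq_zero, ← h2]

lemma hasSum_parseval {q : ℝ → ℂ} (hq : Continuous q) :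
    HasSum (fun k : ℤ => ‖(2 * π : ℂ)⁻¹ * ∫ x in (0 : ℝ)..2 * π, exp (-(k * x * I)) * q x‖ ^ 2)
      ((2 * π)⁻¹ * ∫ x in (0 : ℝ)..2 * π, ‖q x‖ ^ 2) := by
  have hL : MemLp q 2 (volume.restrict (Set.Ioc 0 (2 * π))) := by
    obtain ⟨B, hB⟩ := isCompact_Icc.exists_bound_of_continuousOn (s := Set.Icc 0 (2 * π))
      hq.continuousOn
    refine MemLp.of_bound hq.aestronglyMeasurable B ?_
    filter_upwards [ae_restrict_mem measurableSet_Ioc] with x hx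
    exact hB x (Set.Ioc_subset_Icc_self hx)
  have h := hasSum_sq_fourierCoeffOn Real.two_pi_pos hL
  rw [sub_zero, smul_eq_mul] at h
  convert! h using 3 with k
  rw [fourierCoeffOn_eq_integral, sub_zero]
  have : ∀ x : ℝ, fourier (-k) (x : AddCircle (2 * π)) • q x = exp (-(k * x * I)) * q x := by
    intro x
    rw [fourier_coe_apply, smul_eq_mul]
    congr 2
    push_cast
    field_simp
  simp only [this]
  rw [one_div, Complex.real_smul]
  push_cast
  rfl

lemma coeff_trigFun (F : Finset ℤ) (c : ℤ → ℂ) (y : ℝ) (k : ℤ) :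
    (2 * π : ℂ)⁻¹ * ∫ x in (0 : ℝ)..2 * π, exp (-(k * x * I)) * trigFun F c (x + y * I) =
      if k ∈ F then c k * Real.exp (-(k * y)) else 0 := by
  have h1 : ∀ x : ℝ, exp (-(k * x * I)) * trigFun F c (x + y * I) =
      ∑ j ∈ F, c j * Real.exp (-(j * y)) * exp ((j - k : ℤ) * x * I) := by
    intro x
    rw [trigFun, Finset.mul_sum]
    refine Finset.sum_congr rfl fun j _ => ?_
    push_cast
    rw [mul_left_comm, ← exp_add, mul_assoc (c j), ← exp_add]
    congr 2
    linear_combination (j * y : ℂ) * I_sq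
  simp only [h1]
  rw [intervalIntegral.integral_finsetSum
    (fun j _ => Continuous.intervalIntegrable (by fun_prop) _ _)]
  simp only [intervalIntegral.integral_const_mul, integral_exp_int, sub_eq_zero, mul_ite, mul_zero,
    Finset.sum_ite_eq']
  split_ifs
  · have : (π : ℂ) ≠ 0 := ofReal_ne_zero.2 Real.pi_ne_zero
    field_simp
  · rfl

/-- Parseval at height `y`, where the `k`-th coefficient is `c k * exp(-ky)`. -/
lemma integral_norm_sq_trigFun (F : Finset ℤ) (c : ℤ → ℂ) (y : ℝ) :
    ∫ x in (0 : ℝ)..2 * π, ‖trigFun F c (x + y * I)‖ ^ 2 =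
      2 * π * ∑ k ∈ F, ‖c k‖ ^ 2 * Real.exp (-(2 * k * y)) := by
  have hc : Continuous fun x : ℝ => trigFun F c (x + y * I) :=
    (differentiable_trigFun F c).continuous.comp (by fun_prop)
  have h := hasSum_parseval hc
  simp only [coeff_trigFun] at h
  have h2 := hasSum_sum_of_ne_finset_zero (s := F)
    (f := fun k : ℤ => ‖if k ∈ F then c k * (Real.exp (-(k * y)) : ℂ) else 0‖ ^ 2)
    (L := SummationFilter.unconditional ℤ) (by
      intro k hk; simp [hk])
  have h3 := h.unique h2
  rw [inv_mul_eq_iff_eq_mul₀ Real.two_pi_pos.ne'] at h3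
  rw [h3]
  congr 1
  refine Finset.sum_congr rfl fun k hk => ?_
  rw [if_pos hk, norm_mul, Complex.norm_real, Real.norm_eq_abs, Real.abs_exp, mul_pow,
    ← Real.exp_nat_mul]
  congr 2
  push_cast
  ring

/-- The integral of a periodic holomorphic function over a period does not depend on the height. -/
lemma integral_line_eq {p y₁ y₂ : ℝ} {Φ : ℂ → ℂ}
    (hper : ∀ z : ℂ, z.im ∈ Set.uIcc y₁ y₂ → Φ (z + p) = Φ z)
    (hd : ∀ z : ℂ, z.im ∈ Set.uIcc y₁ y₂ → DifferentiableAt ℂ Φ z) :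
    ∫ x in (0 : ℝ)..p, Φ (x + y₁ * I) = ∫ x in (0 : ℝ)..p, Φ (x + y₂ * I) := by
  have h := integral_boundary_rect_eq_zero_of_differentiableOn Φ (y₁ * I) (p + y₂ * I)
    (fun z hz => (hd z (by simpa using hz.2)).differentiableWithinAt)
  simp only [mul_re, ofReal_re, I_re, mul_zero, ofReal_im, I_im, mul_one, sub_self, add_re,
    add_zero, mul_im, zero_add, add_im, ofReal_zero] at h
  -- The two vertical sides of the rectangle cancel by periodicity.
  have h2 : ∫ y in y₁..y₂, Φ (p + y * I) = ∫ y in y₁..y₂, Φ (y * I) := by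
    refine intervalIntegral.integral_congr fun y hy => ?_
    rw [add_comm]
    exact hper _ (by simpa using hy)
  rw [h2] at h
  linear_combination h

/-! ### A harmonic majorant -/

/-- A harmonic majorant of `|p|²` on the unit disc that is the real part of a polynomial. -/
lemma exists_polynomial_majorant (N : ℕ) (c : ℕ → ℂ) : ∃ G : Polynomial ℂ,
    (∀ w : ℂ, ‖w‖ ≤ 1 → ‖∑ k ∈ Finset.range N, c k * w ^ k‖ ^ 2 ≤ (G.eval w).re) ∧
      G.coeff 0 = ((∑ k ∈ Finset.range N, ‖c k‖ ^ 2 : ℝ) : ℂ) := by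
  induction N generalizing c with
  | zero => exact ⟨0, by simp, by simp⟩
  | succ N ih =>
    obtain ⟨G, h1, h2⟩ := ih fun k => c (k + 1)
    -- With `p = c 0 + w q` one has `|p|² = |c 0|² + |w|²|q|² + Re(2 conj(c 0) w q)`, and `Re G`
    -- majorises `|q|² ≥ |w|²|q|²`. Unrolled, the majorant is the harmonic extension of `|p|²` from
    -- the unit circle, so its constant coefficient is the mean.
    refine ⟨G + Polynomial.C ((‖c 0‖ ^ 2 : ℝ) : ℂ) + Polynomial.C (2 * conj (c 0)) * Polynomial.X *
      ∑ k ∈ Finset.range N, Polynomial.C (c (k + 1)) * Polynomial.X ^ k, fun w hw => ?_, ?_⟩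
    · set q := ∑ k ∈ Finset.range N, c (k + 1) * w ^ k with hq
      have e1 : ∑ k ∈ Finset.range (N + 1), c k * w ^ k = c 0 + w * q := by
        rw [Finset.sum_range_succ', hq, Finset.mul_sum, add_comm]
        congr 1
        · simp
        · exact Finset.sum_congr rfl fun k _ => by ring
      have e2 : ‖c 0 + w * q‖ ^ 2 = ‖c 0‖ ^ 2 + ‖w‖ ^ 2 * ‖q‖ ^ 2 + (2 * conj (c 0) * w * q).re := by
        simp only [← Complex.normSq_eq_norm_sq, Complex.normSq_apply]
        simp
        ring
      have e3 := h1 w hw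
      have e4 : ‖w‖ ^ 2 ≤ 1 := pow_le_one₀ (norm_nonneg _) hw
      simp only [Polynomial.eval_add, Polynomial.eval_C, Polynomial.eval_mul, Polynomial.eval_X,
        Polynomial.eval_finsetSum, Polynomial.eval_pow, add_re, ofReal_re]
      rw [e1, e2, ← hq]
      nlinarith [sq_nonneg ‖q‖]
    · rw [Finset.sum_range_succ']
      simp [h2, mul_assoc, -ofReal_pow]


lemma exists_polynomial_majorant_finset (S : Finset ℕ) (c : ℕ → ℂ) : ∃ G : Polynomial ℂ,
    (∀ w : ℂ, ‖w‖ ≤ 1 → ‖∑ k ∈ S, c k * w ^ k‖ ^ 2 ≤ (G.eval w).re) ∧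
      G.coeff 0 = ((∑ k ∈ S, ‖c k‖ ^ 2 : ℝ) : ℂ) := by
  obtain ⟨N, hN⟩ := Finset.exists_nat_subset_range S
  obtain ⟨G, h1, h2⟩ := exists_polynomial_majorant N fun k => if k ∈ S then c k else 0
  have e1 : ∀ w : ℂ, ∑ k ∈ Finset.range N, (if k ∈ S then c k else 0) * w ^ k =
      ∑ k ∈ S, c k * w ^ k := fun w => by
    rw [← Finset.sum_subset hN fun k _ hk => by simp [hk]]
    exact Finset.sum_congr rfl fun k hk => by rw [if_pos hk]
  have e2 : ∑ k ∈ Finset.range N, ‖if k ∈ S then c k else 0‖ ^ 2 = ∑ k ∈ S, ‖c k‖ ^ 2 := by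
    rw [← Finset.sum_subset hN fun k _ hk => by simp [hk]]
    exact Finset.sum_congr rfl fun k hk => by rw [if_pos hk]
  exact ⟨G, fun w hw => e1 w ▸ h1 w hw, by rw [h2, e2]⟩

/-! ### Inverse lifts of expanding maps -/

lemma convex_closedStrip (ζ : ℝ) : Convex ℝ (closedStrip ζ) := by
  have : closedStrip ζ = Complex.imLm ⁻¹' Set.Icc (-ζ) ζ := by
    ext z; simp [closedStrip, abs_le]
  rw [this]
  exact (convex_Icc _ _).linear_preimage _

lemma ofReal_mem_closedStrip {ζ : ℝ} (hζ : 0 < ζ) (x : ℝ) : (x : ℂ) ∈ closedStrip ζ := by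
  simp [closedStrip, hζ.le]

/-- An identity principle on the strip. -/
lemma eqOn_closedStrip {ζ : ℝ} (hζ : 0 < ζ) {f g : ℂ → ℂ} (hf : AnalyticOnNhd ℂ f (closedStrip ζ))
    (hg : AnalyticOnNhd ℂ g (closedStrip ζ)) (h : ∀ x : ℝ, f x = g x) :
    Set.EqOn f g (closedStrip ζ) := by
  refine hf.eqOn_of_preconnected_of_frequently_eq hg (convex_closedStrip ζ).isPreconnected
    (ofReal_mem_closedStrip hζ 0) ?_
  have h1 : Filter.Tendsto (fun x : ℝ => (x : ℂ)) (nhdsWithin 0 {0}ᶜ)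
      (nhdsWithin ((0 : ℝ) : ℂ) {((0 : ℝ) : ℂ)}ᶜ) := by
    refine continuous_ofReal.continuousWithinAt.tendsto_nhdsWithin fun x hx => ?_
    simpa using hx
  exact h1.frequently (Filter.Frequently.of_forall h)

/-- A lift of a homeomorphism of `ℝ` to a torus map commutes with `2π` up to a multiple. -/
lemma exists_degree {f : Torus → Torus} (g : ℝ ≃ₜ ℝ) (hg : ∀ x : ℝ, ((g x : ℝ) : Torus) = f x) :
    ∃ d : ℤ, ∀ x, g (x + 2 * π) = g x + d * (2 * π) := by
  have h1 : ∀ x, ∃ m : ℤ, g (x + 2 * π) = g x + m * (2 * π) := by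
    intro x
    have h2 : ((g (x + 2 * π) - g x : ℝ) : Torus) = 0 := by
      rw [AddCircle.coe_sub, hg, hg, AddCircle.coe_add_period, sub_self]
    obtain ⟨m, hm⟩ := (AddCircle.coe_eq_zero_iff (2 * π)).1 h2
    refine ⟨m, ?_⟩
    rw [zsmul_eq_mul] at hm
    linarith
  choose m hm using h1
  -- A continuous integer-valued function on the line is constant.
  have hc : Continuous m := by
    rw [Int.isClosedEmbedding_coe_real.isEmbedding.continuous_iff]
    have : ((↑) ∘ m : ℝ → ℝ) = fun x => (g (x + 2 * π) - g x) / (2 * π) := by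
      ext x
      rw [hm x]
      field_simp
      simp
    rw [this]
    have := g.continuous
    fun_prop
  refine ⟨m 0, fun x => ?_⟩
  rw [hm x, PreconnectedSpace.constant inferInstance hc (x := x) (y := 0)]

/-- The analytic extension `v` of the inverse of a lift of a circle map of degree `ε n`, `ε = ±1`,
with quantitative bounds on its derivative. -/
structure InverseLift (v : ℂ → ℂ) (ζ κ Λ : ℝ) (n : ℕ) (ε : ℝ) : Prop where
  zeta_pos : 0 < ζ
  sign : ε = 1 ∨ ε = -1
  analytic : AnalyticOnNhd ℂ v (closedStrip ζ)
  add_period : ∀ z ∈ closedStrip ζ, v (z + (2 * π * n : ℝ)) = v z + 2 * π * ε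
  deriv_add_period : ∀ z ∈ closedStrip ζ, deriv v (z + (2 * π * n : ℝ)) = deriv v z
  deriv_real : ∀ x : ℝ, deriv v x = ε * ‖deriv v x‖
  deriv_conj : ∀ z ∈ closedStrip ζ, deriv v (conj z) = conj (deriv v z)
  norm_deriv_le : ∀ z ∈ closedStrip ζ, ‖deriv v z‖ ≤ Real.exp (π / 3) * ‖deriv v z.re‖
  abs_im_le : ∀ z ∈ closedStrip ζ, |(v z).im| ≤ κ * |z.im|
  distortion : ∀ x y : ℝ, |x - y| ≤ 2 * π → ‖deriv v x‖ ≤ Λ * ‖deriv v y‖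

/-- Since `2π < 7`, seven steps of length at most 1 suffice; for such steps `|a - b|^α ≤ 1`, which
frees the bound of `α`. -/
lemma holder_increment {ℓ : ℂ → ℂ} {ζ : ℝ} (hζ : 0 < ζ) {D α : ℝ≥0}
    (hℓ : HolderOnWith D α ℓ (closedStrip ζ)) (x y : ℝ) (hxy : |x - y| ≤ 2 * π) :
    ‖ℓ x - ℓ y‖ ≤ 7 * D := by
  have h1 : ∀ a b : ℝ, |a - b| ≤ 1 → ‖ℓ a - ℓ b‖ ≤ D := by
    intro a b hab
    have h2 := hℓ.dist_le (ofReal_mem_closedStrip hζ a) (ofReal_mem_closedStrip hζ b)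
    rw [dist_eq_norm, dist_eq_norm, ← ofReal_sub, Complex.norm_real, Real.norm_eq_abs] at h2
    exact h2.trans (mul_le_of_le_one_right D.2
      (Real.rpow_le_one (abs_nonneg _) hab α.2))
  have h2 : ∀ m : ℕ, ‖ℓ (y + m * ((x - y) / 7) : ℝ) - ℓ y‖ ≤ m * D := by
    intro m
    induction m with
    | zero => simp
    | succ m ih =>
      have h3 : ‖ℓ (y + (m + 1 : ℕ) * ((x - y) / 7) : ℝ) - ℓ (y + m * ((x - y) / 7) : ℝ)‖ ≤ D := by
        refine h1 _ _ ?_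
        rw [show y + ((m + 1 : ℕ) : ℝ) * ((x - y) / 7) - (y + m * ((x - y) / 7)) = (x - y) / 7 by
          push_cast; ring, abs_div, abs_of_pos (by norm_num : (0 : ℝ) < 7)]
        linarith [Real.pi_lt_d2]
      calc _ ≤ _ := norm_sub_le_norm_sub_add_norm_sub _ _ _
        _ ≤ D + m * D := add_le_add h3 ih
        _ = _ := by push_cast; ring
  have h4 := h2 7
  rw [show y + ((7 : ℕ) : ℝ) * ((x - y) / 7) = x by push_cast; ring] at h4
  exact_mod_cast h4

/-- Periodicity and conjugation symmetry are checked on the real line and carried to the strip by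
the identity principle. The comparisons of `|v'|` come from `|v'| = exp(Re ℓ)` and the Hölder bound
on `ℓ`. -/
lemma IsExpanding.exists_inverseLift {f : Torus → Torus} {ζ κ : ℝ} {α D : ℝ≥0} (hζ : 0 < ζ)
    (h : IsExpanding f ζ κ α D) :
    ∃ (g : ℝ ≃ₜ ℝ) (v : ℂ → ℂ) (n : ℕ) (ε : ℝ), (∀ x : ℝ, ((g x : ℝ) : Torus) = f x) ∧
      (∀ y : ℝ, v y = (g.symm y : ℝ)) ∧ (∀ z ∈ closedStrip ζ, ‖deriv v z‖ ≤ κ) ∧ 0 < κ ∧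
      InverseLift v ζ κ (Real.exp (7 * D)) n ε := by
  obtain ⟨g, v, hg, hv, han, hκ, ℓ, hexp, hhol⟩ := h.exists_inverse_lift
  have hreal := ofReal_mem_closedStrip hζ
  have hderiv : ∀ x : ℝ, HasDerivAt g.symm (deriv v x).re x := by
    intro x
    have := (han _ (hreal x)).differentiableAt.hasDerivAt.real_of_complex
    simpa [hv] using this
  have hderiv' : ∀ x : ℝ, deriv v x = ((deriv v x).re : ℝ) := by
    intro x
    have h1 := (han _ (hreal x)).differentiableAt.hasDerivAt.comp_ofReal
    have h2 := (hderiv x).ofReal_comp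
    simp only [hv] at h1
    exact h1.unique h2
  obtain ⟨d, hd⟩ := exists_degree g hg
  have hsymm : ∀ y, g.symm (y + d * (2 * π)) = g.symm y + 2 * π := by
    intro y
    rw [g.symm_apply_eq, hd, g.apply_symm_apply]
  -- The inverse lift is strictly monotone in one of the two senses, which fixes the sign `ε` of
  -- both `v'` and the degree `d`; then `n = |d|`.
  obtain ⟨n, ε, hε, hper, hsign⟩ : ∃ (n : ℕ) (ε : ℝ), (ε = 1 ∨ ε = -1) ∧
      (∀ y, g.symm (y + 2 * π * n) = g.symm y + 2 * π * ε) ∧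
      ∀ x : ℝ, (deriv v x).re = ε * |(deriv v x).re| := by
    rcases g.symm.continuous.strictMono_of_inj g.symm.injective with hm | hm
    · have hd0 : 0 ≤ d := by
        by_contra hd0
        have h1 : (d : ℝ) ≤ 0 := by exact_mod_cast (not_le.1 hd0).le
        have h2 := hm.monotone (show 0 + d * (2 * π) ≤ 0 by nlinarith [Real.pi_pos])
        rw [hsymm] at h2
        linarith [Real.pi_pos]
      lift d to ℕ using hd0
      refine ⟨d, 1, Or.inl rfl, fun y => ?_, fun x => ?_⟩
      · rw [mul_one, ← hsymm, mul_comm]; simp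
      · rw [one_mul, abs_of_nonneg]
        rw [← (hderiv x).deriv]
        exact hm.monotone.deriv_nonneg
    · have hd0 : 0 ≤ -d := by
        by_contra hd0
        have h1 : (0 : ℝ) ≤ d := by exact_mod_cast (by linarith : 0 ≤ d)
        have h2 := hm.antitone (show 0 ≤ 0 + d * (2 * π) by nlinarith [Real.pi_pos])
        rw [hsymm] at h2
        linarith [Real.pi_pos]
      obtain ⟨m, hm'⟩ := Int.eq_ofNat_of_zero_le hd0
      have hdm : (d : ℝ) = -m := by
        have : d = -(m : ℤ) := by linarith
        rw [this]; simp
      refine ⟨m, -1, Or.inr rfl, fun y => ?_, fun x => ?_⟩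
      · have := hsymm (y + 2 * π * m)
        rw [hdm, show y + 2 * π * m + -m * (2 * π) = y by ring] at this
        linarith
      · rw [neg_one_mul, abs_of_nonpos, neg_neg]
        rw [← (hderiv x).deriv]
        exact hm.antitone.deriv_nonpos
  have hshift : ∀ z ∈ closedStrip ζ, z + (2 * π * n : ℝ) ∈ closedStrip ζ := by
    intro z hz
    simpa [closedStrip] using hz
  have hnorm : ∀ z ∈ closedStrip ζ, ‖deriv v z‖ = Real.exp (ℓ z).re := by
    intro z hz
    rw [← hexp z hz, Complex.norm_exp]
  have hreper : ∀ x : ℝ, deriv v (x + (2 * π * n : ℝ) : ℂ) = deriv v x := by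
    intro x
    have h1 : HasDerivAt g.symm (deriv v (x + 2 * π * n : ℝ)).re x := by
      have h2 := (hderiv (x + 2 * π * n)).comp_add_const x (2 * π * n)
      simp only [hper] at h2
      simpa using h2.sub_const (2 * π * ε)
    rw [← ofReal_add, hderiv', h1.unique (hderiv x), ← hderiv']
  refine ⟨g, v, n, ε, hg, hv, hκ, ?_, hζ, hε, han, ?_, ?_, ?_, ?_, ?_, ?_, ?_⟩
  · refine lt_of_lt_of_le ?_ (hκ _ (hreal 0))
    rw [hnorm _ (hreal 0)]
    exact Real.exp_pos _
  · have h1 : AnalyticOnNhd ℂ (fun z => v (z + (2 * π * n : ℝ))) (closedStrip ζ) := by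
      intro z hz
      exact (han _ (hshift z hz)).comp_of_eq (by fun_prop) rfl
    refine eqOn_closedStrip hζ h1 (fun z hz => (han z hz).add analyticAt_const) fun x => ?_
    rw [← ofReal_add, hv, hper, hv]
    push_cast; rfl
  · have h1 : AnalyticOnNhd ℂ (fun z => deriv v (z + (2 * π * n : ℝ))) (closedStrip ζ) := by
      intro z hz
      exact (han _ (hshift z hz)).deriv.comp_of_eq (by fun_prop) rfl
    exact eqOn_closedStrip hζ h1 han.deriv hreper
  · intro x
    rw [hderiv' x, Complex.norm_real, Real.norm_eq_abs, ← ofReal_mul]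
    exact congrArg _ (hsign x)
  -- Schwarz reflection: this function is analytic and agrees with `v'` on the real line, where `v'`
  -- is real.
  · have h1 : AnalyticOnNhd ℂ (fun z => conj (deriv v (conj z))) (closedStrip ζ) := by
      intro z hz
      have hz' : conj z ∈ closedStrip ζ := by simpa [closedStrip] using hz
      have h2 := (han _ hz').deriv.eventually_analyticAt
      rw [Complex.analyticAt_iff_eventually_differentiableAt]
      have h3 := continuous_conj.tendsto z
      filter_upwards [h3.eventually h2] with w hw
      simpa [Function.comp_def] using hw.differentiableAt.conj_conj
    intro z hz
    have h4 := eqOn_closedStrip hζ h1 han.deriv (fun x => by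
      rw [conj_ofReal, hderiv' x, conj_ofReal]) hz
    rw [← h4, conj_conj]
  · intro z hz
    rw [hnorm z hz, hnorm _ (hreal _), ← Real.exp_add, Real.exp_le_exp]
    have h1 := hhol.dist_le hz (hreal z.re)
    have h2 : dist z (z.re : ℂ) = |z.im| := by
      rw [dist_eq_norm, show z - z.re = z.im * I by linear_combination -(re_add_im z)]
      simp
    rw [h2, dist_eq_norm] at h1
    have h3 : |z.im| ^ (α : ℝ) ≤ ζ ^ (α : ℝ) := Real.rpow_le_rpow (abs_nonneg _) hz α.2
    -- The hypothesis on `D` bounds the variation of `ℓ` between `Re z` and `z` by `π/3`; every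
    -- factor `exp(π/3)` originates here.
    have h4 : (D : ℝ) * ζ ^ (α : ℝ) ≤ π / 3 := by
      have := h.D_le
      rwa [Real.rpow_neg hζ.le, ← div_eq_mul_inv, le_div_iff₀ (Real.rpow_pos_of_pos hζ _)] at this
    have h5 := (Complex.re_le_norm (ℓ z - ℓ z.re)).trans
      (h1.trans ((mul_le_mul_of_nonneg_left h3 D.2).trans h4))
    rw [sub_re] at h5
    linarith
  · intro z hz
    -- As `v (Re z)` is real, `Im (v z)` is the imaginary part of the increment of `v` along a
    -- vertical segment.
    have h1 := (convex_closedStrip ζ).norm_image_sub_le_of_norm_deriv_le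
      (fun z hz => (han z hz).differentiableAt) hκ (hreal z.re) hz
    have h2 : ‖z - (z.re : ℂ)‖ = |z.im| := by
      rw [show z - z.re = z.im * I by linear_combination -(re_add_im z)]
      simp
    rw [h2] at h1
    refine le_trans ?_ h1
    have h3 := Complex.abs_im_le_norm (v z - v z.re)
    rwa [sub_im, hv z.re, ofReal_im, sub_zero, ← hv z.re] at h3
  · intro x y hxy
    rw [hnorm _ (hreal _), hnorm _ (hreal _), ← Real.exp_add, Real.exp_le_exp]
    have h5 := (Complex.re_le_norm (ℓ x - ℓ y)).trans (holder_increment hζ hhol x y hxy)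
    rw [sub_re] at h5
    linarith

lemma add_mul_I_mem_closedStrip {ζ y : ℝ} (hy : |y| ≤ ζ) (x : ℝ) :
    (x + y * I : ℂ) ∈ closedStrip ζ := by
  simpa [closedStrip] using hy

lemma continuous_line {ζ y : ℝ} (hy : |y| ≤ ζ) {A : ℂ → ℂ} (hA : ContinuousOn A (closedStrip ζ)) :
    Continuous fun x : ℝ => A (x + y * I) :=
  hA.comp_continuous (by fun_prop) (add_mul_I_mem_closedStrip hy)

/-- Reindexing by `|k|` turns a trigonometric polynomial with one-sided spectrum into a polynomial
in `exp(iδz)`. -/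
lemma sum_filter_natAbs {δ : ℤ} (hδ : δ = 1 ∨ δ = -1) {F : Finset ℤ} (hF : ∀ k ∈ F, 0 ≤ δ * k)
    {E : Type*} [AddCommMonoid E] (u : ℤ → E) :
    ∑ k ∈ F, u k = ∑ m ∈ F.image Int.natAbs, u (δ * m) := by
  have h1 : ∀ k ∈ F, δ * (k.natAbs : ℤ) = k := by
    intro k hk
    have := hF k hk
    rcases hδ with rfl | rfl <;> omega
  rw [Finset.sum_image]
  · exact Finset.sum_congr rfl fun k hk => by rw [h1 k hk]
  · intro j hj k hk hjk
    rw [← h1 j hj, ← h1 k hk, hjk]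

/-! ### Integrals over a period of `v'` on the real line -/

namespace InverseLift

variable {v : ℂ → ℂ} {ζ κ Λ : ℝ} {n : ℕ} {ε : ℝ}

lemma continuous_deriv (h : InverseLift v ζ κ Λ n ε) : Continuous fun x : ℝ => deriv v x := by
  have := continuous_line (y := 0) (by simpa using h.zeta_pos.le) h.analytic.deriv.continuousOn
  simpa using this

lemma continuous_deriv_line (h : InverseLift v ζ κ Λ n ε) {y : ℝ} (hy : |y| ≤ ζ) :
    Continuous fun x : ℝ => deriv v (x + y * I) :=
  continuous_line hy h.analytic.deriv.continuousOn

lemma continuous_comp_line (h : InverseLift v ζ κ Λ n ε) {y : ℝ} (hy : |y| ≤ ζ) :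
    Continuous fun x : ℝ => v (x + y * I) :=
  continuous_line hy h.analytic.continuousOn

lemma continuous_weight (h : InverseLift v ζ κ Λ n ε) : Continuous fun x : ℝ => ‖deriv v x‖ :=
  h.continuous_deriv.norm

lemma sign_sq (h : InverseLift v ζ κ Λ n ε) : ε * ε = 1 := by
  rcases h.sign with rfl | rfl <;> norm_num

/-- On the real line `|v'|` is the restriction of the holomorphic function `ε v'`; this permits
contour shifts in integrals weighted by `|v'|`. -/
lemma weight_eq (h : InverseLift v ζ κ Λ n ε) (x : ℝ) : (‖deriv v x‖ : ℂ) = ε * deriv v x := by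
  have h1 := h.deriv_real x
  generalize ‖deriv v x‖ = w at h1 ⊢
  rw [h1, ← mul_assoc, ← ofReal_mul, h.sign_sq, ofReal_one, one_mul]

lemma hasDerivAt_line (h : InverseLift v ζ κ Λ n ε) (x : ℝ) :
    HasDerivAt (fun y : ℝ => v y) (deriv v x) x :=
  (h.analytic _ (ofReal_mem_closedStrip h.zeta_pos x)).differentiableAt.hasDerivAt.comp_ofReal

lemma apply_period (h : InverseLift v ζ κ Λ n ε) :
    v (2 * π * n : ℝ) = v (0 : ℝ) + 2 * π * ε := by
  rw [← h.add_period _ (ofReal_mem_closedStrip h.zeta_pos 0), ofReal_zero, zero_add]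

lemma integral_deriv (h : InverseLift v ζ κ Λ n ε) :
    ∫ x in (0 : ℝ)..2 * π * n, deriv v x = 2 * π * ε := by
  rw [intervalIntegral.integral_eq_sub_of_hasDerivAt (fun x _ => h.hasDerivAt_line x)
    (h.continuous_deriv.intervalIntegrable _ _), h.apply_period]
  ring

lemma integral_weight (h : InverseLift v ζ κ Λ n ε) :
    ∫ x in (0 : ℝ)..2 * π * n, ‖deriv v x‖ = 2 * π := by
  have h1 : ((∫ x in (0 : ℝ)..2 * π * n, ‖deriv v x‖ : ℝ) : ℂ) = (2 * π : ℝ) := by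
    rw [← intervalIntegral.integral_ofReal]
    simp only [h.weight_eq]
    rw [intervalIntegral.integral_const_mul, h.integral_deriv]
    push_cast
    rw [mul_left_comm, ← ofReal_mul, h.sign_sq]
    simp
  exact_mod_cast h1

/-- The transfer operator is bounded on `L^1`-type averages, uniformly in the degree. -/
lemma integral_weight_mul_le (h : InverseLift v ζ κ Λ n ε) {q : ℝ → ℝ} (hq : Continuous q)
    (hq0 : ∀ x, 0 ≤ q x) (hper : Function.Periodic q (2 * π)) :
    ∫ x in (0 : ℝ)..2 * π * n, ‖deriv v x‖ * q x ≤ Λ * ∫ x in (0 : ℝ)..2 * π, q x := by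
  have hW := h.continuous_weight
  have hi : ∀ {u : ℝ → ℝ}, Continuous u → ∀ a b, IntervalIntegrable u volume a b :=
    fun hu a b => hu.intervalIntegrable a b
  have hWq : Continuous fun x : ℝ => ‖deriv v x‖ * q x := hW.mul hq
  have e0 : (2 * π * (0 : ℕ) : ℝ) = 0 := by simp
  have e1 : ∫ x in (0 : ℝ)..2 * π * n, ‖deriv v x‖ * q x = ∑ j ∈ Finset.range n,
      ∫ x in (2 * π * j : ℝ)..2 * π * (j + 1 : ℕ), ‖deriv v x‖ * q x := by
    rw [intervalIntegral.sum_integral_adjacent_intervals (a := fun j : ℕ => 2 * π * (j : ℝ))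
      fun _ _ => hi hWq _ _, e0]
  have e2 : ∫ x in (0 : ℝ)..2 * π * n, ‖deriv v x‖ = ∑ j ∈ Finset.range n,
      ∫ x in (2 * π * j : ℝ)..2 * π * (j + 1 : ℕ), ‖deriv v x‖ := by
    rw [intervalIntegral.sum_integral_adjacent_intervals (a := fun j : ℕ => 2 * π * (j : ℝ))
      fun _ _ => hi hW _ _, e0]
  -- The `n` cells have total `|v'|`-mass `2π`, so bounding `|v'|` on each cell by `Λ/(2π)` times
  -- the mass of that cell costs no factor `n`.
  have e3 : Λ * ∫ x in (0 : ℝ)..2 * π, q x = ∑ j ∈ Finset.range n,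
      (Λ / (2 * π) * ∫ x in (2 * π * j : ℝ)..2 * π * (j + 1 : ℕ), ‖deriv v x‖) *
        ∫ x in (0 : ℝ)..2 * π, q x := by
    rw [← Finset.sum_mul, ← Finset.mul_sum, ← e2, h.integral_weight, div_mul_cancel₀]
    exact Real.two_pi_pos.ne'
  rw [e1, e3]
  refine Finset.sum_le_sum fun j _ => ?_
  have hle : (2 * π * j : ℝ) ≤ 2 * π * (j + 1 : ℕ) := by
    push_cast; nlinarith [Real.pi_pos]
  have e4 : ∫ x in (0 : ℝ)..2 * π, q x =
      ∫ x in (2 * π * j : ℝ)..2 * π * (j + 1 : ℕ), q x := by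
    have := hper.intervalIntegral_add_eq 0 (2 * π * j)
    rw [zero_add] at this
    rw [this]
    congr 1
    push_cast; ring
  rw [e4, ← intervalIntegral.integral_const_mul]
  refine intervalIntegral.integral_mono_on hle (hi hWq _ _)
    (hi (continuous_const.mul hq) _ _) fun x hx => ?_
  refine mul_le_mul_of_nonneg_right ?_ (hq0 x)
  -- The distortion inequality, averaged over its second point.
  have h2 : ∫ _ in (2 * π * j : ℝ)..2 * π * (j + 1 : ℕ), ‖deriv v x‖ ≤
      ∫ u in (2 * π * j : ℝ)..2 * π * (j + 1 : ℕ), Λ * ‖deriv v u‖ := by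
    refine intervalIntegral.integral_mono_on hle (hi continuous_const _ _)
      (hi (continuous_const.mul hW) _ _) fun u hu => h.distortion _ _ ?_
    push_cast at hx hu
    rw [abs_le]
    constructor <;> nlinarith [hx.1, hx.2, hu.1, hu.2]
  rw [intervalIntegral.integral_const, intervalIntegral.integral_const_mul, smul_eq_mul,
    show 2 * π * ((j + 1 : ℕ) : ℝ) - 2 * π * j = 2 * π by push_cast; ring] at h2
  rw [div_mul_eq_mul_div, le_div_iff₀ Real.two_pi_pos]
  linarith

lemma norm_deriv_line_le (h : InverseLift v ζ κ Λ n ε) {y : ℝ} (hy : |y| ≤ ζ) (x : ℝ) :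
    ‖deriv v (x + y * I)‖ ≤ Real.exp (π / 3) * ‖deriv v x‖ := by
  have := h.norm_deriv_le _ (add_mul_I_mem_closedStrip hy x)
  simpa using this

/-- The integral of a polynomial in `exp (± i v)` against `v'`. -/
lemma integral_deriv_mul_eval (h : InverseLift v ζ κ Λ n ε) (G : Polynomial ℂ) {δ : ℤ}
    (hδ : δ = 1 ∨ δ = -1) (s : ℝ) :
    ∫ x in (0 : ℝ)..2 * π * n, deriv v x * G.eval (exp (δ * v x * I - s)) =
      2 * π * ε * G.coeff 0 := by
  have hcv : Continuous fun x : ℝ => v x :=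
    continuous_iff_continuousAt.2 fun x => (h.hasDerivAt_line x).continuousAt
  have hcd := h.continuous_deriv
  have hce : Continuous fun x : ℝ => exp (δ * v x * I - s) :=
    (((continuous_const.mul hcv).mul continuous_const).sub continuous_const).cexp
  have hc : ∀ P : Polynomial ℂ, Continuous fun x : ℝ =>
      deriv v x * P.eval (exp (δ * v x * I - s)) := fun P =>
    hcd.mul (P.continuous.comp hce)
  induction G using Polynomial.induction_on' with
  | add P Q hP hQ =>
    simp only [Polynomial.eval_add, mul_add, Polynomial.coeff_add]
    rw [intervalIntegral.integral_add ((hc P).intervalIntegrable _ _)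
      ((hc Q).intervalIntegrable _ _), hP, hQ]
  | monomial k a =>
    simp only [Polynomial.eval_monomial, Polynomial.coeff_monomial]
    rcases eq_or_ne k 0 with rfl | hk
    · simp only [pow_zero, mul_one, if_true]
      rw [intervalIntegral.integral_mul_const, h.integral_deriv]
    · rw [if_neg hk, mul_zero]
      have hδ0 : (δ : ℂ) ≠ 0 := by rcases hδ with rfl | rfl <;> simp
      have hk0 : (k : ℂ) * (δ * I) ≠ 0 :=
        mul_ne_zero (Nat.cast_ne_zero.2 hk) (mul_ne_zero hδ0 I_ne_zero)
      -- For `k ≥ 1` the integrand has this antiderivative, which takes equal values at both ends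
      -- because `v` changes by `2πε`.
      have hd : ∀ x : ℝ, HasDerivAt
          (fun x : ℝ => a / (k * (δ * I)) * exp (k * (δ * v x * I - s)))
          (deriv v x * (a * exp (δ * v x * I - s) ^ k)) x := by
        intro x
        have h1 := ((((((h.hasDerivAt_line x).const_mul (δ : ℂ)).mul_const I).sub_const
          (s : ℂ)).const_mul (k : ℂ)).cexp).const_mul (a / (k * (δ * I)))
        convert! h1 using 1
        rw [← exp_nat_mul]
        field_simp
      rw [intervalIntegral.integral_eq_sub_of_hasDerivAt (fun x _ => hd x)
        ((hcd.mul (continuous_const.mul (hce.pow k))).intervalIntegrable _ _), h.apply_period, sub_eq_zero]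
      congr 1
      have : ∃ m : ℤ, (δ : ℂ) * ε = m := by
        rcases hδ with rfl | rfl <;> rcases h.sign with rfl | rfl
        exacts [⟨1, by simp⟩, ⟨-1, by simp⟩, ⟨-1, by simp⟩, ⟨1, by simp⟩]
      obtain ⟨m, hm⟩ := this
      rw [show (k : ℂ) * (δ * (v (0 : ℝ) + 2 * π * ε) * I - s) =
        k * (δ * v (0 : ℝ) * I - s) + ((k * m : ℤ) : ℂ) * (2 * π * I) by
          push_cast; linear_combination (k * 2 * π * I : ℂ) * hm, exp_add,
        exp_int_mul_two_pi_mul_I, mul_one]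

end InverseLift

/-! ### Contour shifts in the strip and composition with `v` -/

lemma mem_closedStrip_of_uIcc {ζ a b : ℝ} (ha : |a| ≤ ζ) (hb : |b| ≤ ζ) {z : ℂ}
    (hz : z.im ∈ Set.uIcc a b) : z ∈ closedStrip ζ := by
  have h1 := (Set.uIcc_subset_Icc (abs_le.1 ha) (abs_le.1 hb)) hz
  exact abs_le.2 h1

namespace InverseLift

variable {v : ℂ → ℂ} {ζ κ Λ : ℝ} {n : ℕ} {ε : ℝ}

lemma exp_comp_add_period (h : InverseLift v ζ κ Λ n ε) {δ : ℤ} (hδ : δ = 1 ∨ δ = -1) (s : ℝ)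
    {z : ℂ} (hz : z ∈ closedStrip ζ) :
    exp (δ * v (z + (2 * π * n : ℝ)) * I - s) = exp (δ * v z * I - s) := by
  have : ∃ m : ℤ, (δ : ℂ) * ε = m := by
    rcases hδ with rfl | rfl <;> rcases h.sign with rfl | rfl
    exacts [⟨1, by simp⟩, ⟨-1, by simp⟩, ⟨-1, by simp⟩, ⟨1, by simp⟩]
  obtain ⟨m, hm⟩ := this
  rw [h.add_period z hz, show (δ : ℂ) * (v z + 2 * π * ε) * I - s =
    δ * v z * I - s + (m : ℂ) * (2 * π * I) by
      linear_combination (2 * π * I : ℂ) * hm, exp_add, exp_int_mul_two_pi_mul_I, mul_one]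

/-- The norm is `exp(-δ Im (v z) - s)`, and `|Im (v z)| ≤ κ|Im z| ≤ s`. Thus the composite stays in
the disc where the majorant is valid. -/
lemma norm_exp_comp_le (h : InverseLift v ζ κ Λ n ε) {δ : ℤ} (hδ : δ = 1 ∨ δ = -1) {s : ℝ}
    {z : ℂ} (hz : z ∈ closedStrip ζ) (hs : κ * |z.im| ≤ s) :
    ‖exp (δ * v z * I - s)‖ ≤ 1 := by
  rw [Complex.norm_exp, Real.exp_le_one_iff]
  have h1 := abs_le.1 ((h.abs_im_le z hz).trans hs)
  rcases hδ with rfl | rfl <;> simp <;> linarith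

/-- A harmonic function `Re F` with `F = G ∘ exp (± i v)`, positive on the strip, has a weighted
integral over horizontal lines that is controlled by the one over the real line. -/
lemma integral_weight_mul_re_le (h : InverseLift v ζ κ Λ n ε) {G : Polynomial ℂ}
    (hG : ∀ w : ℂ, ‖w‖ ≤ 1 → 0 ≤ (G.eval w).re) {δ : ℤ} (hδ : δ = 1 ∨ δ = -1) {s y : ℝ}
    (hy : |y| ≤ ζ) (hs : κ * |y| ≤ s) (hs0 : 0 ≤ s) :
    ∫ x in (0 : ℝ)..2 * π * n, ‖deriv v x‖ * (G.eval (exp (δ * v (x + y * I) * I - s))).re ≤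
      Real.exp (π / 3) * (4 * π * (G.coeff 0).re) := by
  set F : ℂ → ℂ := fun z => G.eval (exp (δ * v z * I - s)) with hF
  have hy' : |-y| ≤ ζ := by rwa [abs_neg]
  have h0 : |(0 : ℝ)| ≤ ζ := by simpa using h.zeta_pos.le
  have hFd : ∀ z ∈ closedStrip ζ, DifferentiableAt ℂ F z := fun z hz =>
    G.differentiable.differentiableAt.comp z
      ((((h.analytic z hz).differentiableAt.const_mul _).mul_const _).sub_const _).cexp
  have hFc : ContinuousOn F (closedStrip ζ) := fun z hz =>
    (hFd z hz).continuousAt.continuousWithinAt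
  have hFper : ∀ z ∈ closedStrip ζ, F (z + (2 * π * n : ℝ)) = F z := fun z hz => by
    simp only [hF, h.exp_comp_add_period hδ s hz]
  have hi : ∀ {u : ℝ → ℂ}, Continuous u → IntervalIntegrable u volume 0 (2 * π * n) :=
    fun hu => hu.intervalIntegrable _ _
  have hir : ∀ {u : ℝ → ℝ}, Continuous u → IntervalIntegrable u volume 0 (2 * π * n) :=
    fun hu => hu.intervalIntegrable _ _
  have hF0 : Continuous fun x : ℝ => F x := by
    simpa using continuous_line h0 hFc
  have hdF : ∀ u : ℝ, |u| ≤ ζ → Continuous fun x : ℝ => deriv v (x + u * I) * F x :=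
    fun u hu => (h.continuous_deriv_line hu).mul hF0
  have hpos : ∀ z ∈ closedStrip ζ, κ * |z.im| ≤ s → 0 ≤ (F z).re := fun z hz hzs =>
    hG _ (h.norm_exp_comp_le hδ hz hzs)
  have hp0 : (0 : ℝ) ≤ 2 * π * n := by positivity
  -- shifting the contour
  have hshift : ∀ u : ℝ, |u| ≤ ζ → ∫ x in (0 : ℝ)..2 * π * n, deriv v x * F (x + u * I) =
      ∫ x in (0 : ℝ)..2 * π * n, deriv v (x + (-u : ℝ) * I) * F x := by
    intro u hu
    have hz1 : ∀ z : ℂ, z.im ∈ Set.uIcc 0 (-u) → z ∈ closedStrip ζ := fun z hz =>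
      mem_closedStrip_of_uIcc h0 (by rwa [abs_neg]) hz
    have hz2 : ∀ z : ℂ, z.im ∈ Set.uIcc 0 (-u) → z + u * I ∈ closedStrip ζ := by
      intro z hz
      refine mem_closedStrip_of_uIcc hu h0 (z := z + u * I) ?_
      have : (z + u * I).im = z.im + u := by simp
      rw [this]
      rcases Set.mem_uIcc.1 hz with h1 | h1
      · exact Set.mem_uIcc.2 (Or.inl ⟨by linarith, by linarith⟩)
      · exact Set.mem_uIcc.2 (Or.inr ⟨by linarith, by linarith⟩)
    have h1 := integral_line_eq (p := 2 * π * n) (y₁ := 0) (y₂ := -u)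
      (Φ := fun z => deriv v z * F (z + u * I))
      (fun z hz => by
        rw [h.deriv_add_period z (hz1 z hz), add_right_comm, hFper _ (hz2 z hz)])
      (fun z hz => (h.analytic.deriv z (hz1 z hz)).differentiableAt.mul
        ((hFd _ (hz2 z hz)).comp z (f := fun z : ℂ => z + u * I) (by fun_prop)))
    simpa [add_assoc] using h1
  -- Since the weight is `ε v'`, a shift of `F` by `u` is exchanged for a shift of `v'` by `-u`.
  have hre : ∀ u : ℝ, |u| ≤ ζ →
      ∫ x in (0 : ℝ)..2 * π * n, ‖deriv v x‖ * (F (x + u * I)).re =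
        ε * (∫ x in (0 : ℝ)..2 * π * n, deriv v (x + (-u : ℝ) * I) * F x).re := by
    intro u hu
    rw [← hshift u hu, ← re_ofReal_mul, ← intervalIntegral.integral_const_mul]
    have h1 : ∀ x : ℝ, (ε : ℂ) * (deriv v x * F (x + u * I)) =
        (‖deriv v x‖ : ℂ) * F (x + u * I) := fun x => by rw [h.weight_eq, mul_assoc]
    simp only [h1]
    rw [← reCLM_apply, ← reCLM.intervalIntegral_comp_comm (hi ?_)]
    · simp only [reCLM_apply, re_ofReal_mul]
    · have := h.continuous_weight
      exact (continuous_ofReal.comp this).mul (continuous_line hu hFc)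
  -- Adding the nonnegative integral at height `-y` produces the weight `v'(x - iy) + v'(x + iy)`,
  -- which is real; hence only `Re F`, and not `Im F`, enters on the real line.
  have hsum : ∫ x in (0 : ℝ)..2 * π * n, ‖deriv v x‖ * (F (x + y * I)).re ≤
      ∫ x in (0 : ℝ)..2 * π * n, 2 * Real.exp (π / 3) * (‖deriv v x‖ * (F x).re) := by
    have h1 : 0 ≤ ∫ x in (0 : ℝ)..2 * π * n, ‖deriv v x‖ * (F (x + (-y : ℝ) * I)).re := by
      refine intervalIntegral.integral_nonneg hp0 fun x _ => mul_nonneg (norm_nonneg _) ?_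
      exact hpos _ (add_mul_I_mem_closedStrip hy' x) (by simpa using hs)
    refine (le_add_of_nonneg_right h1).trans ?_
    rw [hre y hy, hre (-y) hy', neg_neg, ← mul_add, ← add_re, ← intervalIntegral.integral_add
      (hi (hdF _ hy')) (hi (hdF _ hy))]
    have h2 : ∀ x : ℝ, deriv v (x + (-y : ℝ) * I) * F x + deriv v (x + y * I) * F x =
        ((2 * (deriv v (x + y * I)).re : ℝ) : ℂ) * F x := by
      intro x
      have h3 := h.deriv_conj _ (add_mul_I_mem_closedStrip hy x)
      have h4 : conj (x + y * I : ℂ) = x + (-y : ℝ) * I := by simp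
      rw [h4] at h3
      rw [h3, ← add_mul, add_comm, Complex.add_conj]
    simp only [h2]
    have hc2 : Continuous fun x : ℝ => 2 * (deriv v (x + y * I)).re :=
      continuous_const.mul (continuous_re.comp (h.continuous_deriv_line hy))
    have hc3 : Continuous fun x : ℝ => (ε : ℂ) * (((2 * (deriv v (x + y * I)).re : ℝ) : ℂ) * F x) :=
      continuous_const.mul ((continuous_ofReal.comp hc2).mul hF0)
    rw [← re_ofReal_mul, ← intervalIntegral.integral_const_mul, ← reCLM_apply,
      ← reCLM.intervalIntegral_comp_comm (hi hc3)]
    simp only [reCLM_apply, re_ofReal_mul]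
    refine intervalIntegral.integral_mono_on hp0
      (hir (continuous_const.mul (hc2.mul (continuous_re.comp hF0))))
      (hir (continuous_const.mul (h.continuous_weight.mul (continuous_re.comp hF0))))
      fun x _ => ?_
    have h5 : 0 ≤ (F x).re := hpos _ (ofReal_mem_closedStrip h.zeta_pos x) (by simpa using hs0)
    have h6 : |(deriv v (x + y * I)).re| ≤ Real.exp (π / 3) * ‖deriv v x‖ :=
      (abs_re_le_norm _).trans (h.norm_deriv_line_le hy x)
    have h7 : ε * (2 * (deriv v (x + y * I)).re) ≤ 2 * Real.exp (π / 3) * ‖deriv v x‖ := by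
      rw [abs_le] at h6
      rcases h.sign with rfl | rfl <;> linarith [h6.1, h6.2]
    calc _ = ε * (2 * (deriv v (x + y * I)).re) * (F x).re := by ring
      _ ≤ 2 * Real.exp (π / 3) * ‖deriv v x‖ * (F x).re := mul_le_mul_of_nonneg_right h7 h5
      _ = _ := by ring
  refine hsum.trans (le_of_eq ?_)
  have h8 := hre 0 h0
  simp only [ofReal_zero, zero_mul, add_zero, neg_zero] at h8
  have h9 : ∫ x in (0 : ℝ)..2 * π * n, deriv v x * F x = 2 * π * ε * G.coeff 0 :=
    h.integral_deriv_mul_eval G hδ s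
  rw [intervalIntegral.integral_const_mul, h8, h9,
    show (2 * π * ε * G.coeff 0 : ℂ) = ((2 * π * ε : ℝ) : ℂ) * G.coeff 0 by push_cast; ring,
    re_ofReal_mul]
  linear_combination (4 * Real.exp (π / 3) * π * (G.coeff 0).re) * h.sign_sq

/-- A Carleson-type estimate for trigonometric polynomials with one-sided spectrum. -/
lemma integral_weight_mul_trigFun_le_of_sign (h : InverseLift v ζ κ Λ n ε) {δ : ℤ}
    (hδ : δ = 1 ∨ δ = -1) {F : Finset ℤ} (hF : ∀ k ∈ F, 0 ≤ δ * k) (c : ℤ → ℂ) {s y : ℝ}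
    (hy : |y| ≤ ζ) (hs : κ * |y| ≤ s) (hs0 : 0 ≤ s) :
    ∫ x in (0 : ℝ)..2 * π * n, ‖deriv v x‖ * ‖trigFun F c (v (x + y * I))‖ ^ 2 ≤
      Real.exp (π / 3) * (8 * π * ∑ k ∈ F, Real.cosh (2 * k * s) * ‖c k‖ ^ 2) := by
  -- With `w = exp(iδz - s)`, the mode `exp(ikz)` becomes `exp(ms) w^m`, `m = |k|`. The constant
  -- coefficient of the majorant is then `∑ exp(2ms)|c|² ≤ 2 ∑ cosh(2ks)|c|²`.
  obtain ⟨G, hG1, hG2⟩ := exists_polynomial_majorant_finset (F.image Int.natAbs)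
    fun m => c (δ * m) * Real.exp (m * s)
  have e1 : ∀ z : ℂ, trigFun F c z = ∑ m ∈ F.image Int.natAbs,
      c (δ * m) * Real.exp (m * s) * exp (δ * z * I - s) ^ m := by
    intro z
    rw [trigFun, sum_filter_natAbs hδ hF]
    refine Finset.sum_congr rfl fun m _ => ?_
    rw [ofReal_exp, mul_assoc (c _), ← exp_nat_mul, ← exp_add]
    congr 2
    push_cast
    ring
  have e2 : ∀ z ∈ closedStrip ζ, κ * |z.im| ≤ s →
      ‖trigFun F c (v z)‖ ^ 2 ≤ (G.eval (exp (δ * v z * I - s))).re := by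
    intro z hz hzs
    rw [e1]
    exact hG1 _ (h.norm_exp_comp_le hδ hz hzs)
  have hcv := h.continuous_comp_line hy
  have e3 : ∫ x in (0 : ℝ)..2 * π * n, ‖deriv v x‖ * ‖trigFun F c (v (x + y * I))‖ ^ 2 ≤
      ∫ x in (0 : ℝ)..2 * π * n, ‖deriv v x‖ * (G.eval (exp (δ * v (x + y * I) * I - s))).re := by
    refine intervalIntegral.integral_mono_on (by positivity) ?_ ?_ fun x _ =>
      mul_le_mul_of_nonneg_left (e2 _ (add_mul_I_mem_closedStrip hy x) (by simpa using hs))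
        (norm_nonneg _)
    · exact (h.continuous_weight.mul
        (((differentiable_trigFun F c).continuous.comp hcv).norm.pow 2)).intervalIntegrable _ _
    · refine (h.continuous_weight.mul (continuous_re.comp
        (G.continuous.comp ?_))).intervalIntegrable _ _
      exact (((continuous_const.mul hcv).mul continuous_const).sub continuous_const).cexp
  refine e3.trans ((h.integral_weight_mul_re_le
    (fun w hw => (sq_nonneg _).trans (hG1 w hw)) hδ hy hs hs0).trans ?_)
  refine mul_le_mul_of_nonneg_left ?_ (Real.exp_pos _).le
  rw [hG2, ofReal_re, sum_filter_natAbs hδ hF, show 8 * π = 4 * π * 2 by ring, mul_assoc (4 * π)]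
  refine mul_le_mul_of_nonneg_left ?_ (by positivity)
  rw [Finset.mul_sum]
  refine Finset.sum_le_sum fun m _ => ?_
  rw [norm_mul, Complex.norm_real, Real.norm_eq_abs, Real.abs_exp, mul_pow, ← Real.exp_nat_mul,
    mul_comm, ← mul_assoc (2 : ℝ) (Real.cosh _)]
  refine mul_le_mul_of_nonneg_right ?_ (sq_nonneg _)
  have e4 : Real.cosh (2 * (δ * m : ℤ) * s) = Real.cosh (2 * (m * s)) := by
    rcases hδ with rfl | rfl
    · congr 1; push_cast; ring
    · rw [← Real.cosh_neg]; congr 1; push_cast; ring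
  rw [e4, Real.cosh_eq]
  push_cast
  linarith [Real.exp_pos (-(2 * (m * s)))]

/-- The frequencies are split by sign, and `|a + b|² ≤ 2|a|² + 2|b|²` doubles the constant. -/
lemma integral_weight_mul_trigFun_le (h : InverseLift v ζ κ Λ n ε) (F : Finset ℤ) (c : ℤ → ℂ)
    {s y : ℝ} (hy : |y| ≤ ζ) (hs : κ * |y| ≤ s) (hs0 : 0 ≤ s) :
    ∫ x in (0 : ℝ)..2 * π * n, ‖deriv v x‖ * ‖trigFun F c (v (x + y * I))‖ ^ 2 ≤
      Real.exp (π / 3) * (16 * π * ∑ k ∈ F, Real.cosh (2 * k * s) * ‖c k‖ ^ 2) := by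
  set F₁ := F.filter fun k => 0 ≤ k
  set F₂ := F.filter fun k => ¬ 0 ≤ k
  have h1 := h.integral_weight_mul_trigFun_le_of_sign (δ := 1) (Or.inl rfl) (F := F₁)
    (fun k hk => by simpa using (Finset.mem_filter.1 hk).2) c hy hs hs0
  have h2 := h.integral_weight_mul_trigFun_le_of_sign (δ := -1) (Or.inr rfl) (F := F₂)
    (fun k hk => by have := (Finset.mem_filter.1 hk).2; linarith) c hy hs hs0
  have hsplit : ∀ z, trigFun F c z = trigFun F₁ c z + trigFun F₂ c z := fun z =>
    (Finset.sum_filter_add_sum_filter_not F _ _).symm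
  have hsum := Finset.sum_filter_add_sum_filter_not F (fun k => 0 ≤ k)
    fun k : ℤ => Real.cosh (2 * k * s) * ‖c k‖ ^ 2
  have hcv := h.continuous_comp_line hy
  have hi : ∀ F' : Finset ℤ, Continuous fun x : ℝ =>
      ‖deriv v x‖ * ‖trigFun F' c (v (x + y * I))‖ ^ 2 := fun F' =>
    h.continuous_weight.mul (((differentiable_trigFun F' c).continuous.comp hcv).norm.pow 2)
  have hi2 : ∀ F' : Finset ℤ, Continuous fun x : ℝ =>
      2 * (‖deriv v x‖ * ‖trigFun F' c (v (x + y * I))‖ ^ 2) := fun F' =>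
    continuous_const.mul (hi F')
  calc _ ≤ ∫ x in (0 : ℝ)..2 * π * n, (2 * (‖deriv v x‖ * ‖trigFun F₁ c (v (x + y * I))‖ ^ 2) +
        2 * (‖deriv v x‖ * ‖trigFun F₂ c (v (x + y * I))‖ ^ 2)) := by
        refine intervalIntegral.integral_mono_on (by positivity) ((hi F).intervalIntegrable _ _)
          (((hi2 F₁).add (hi2 F₂)).intervalIntegrable _ _) fun x _ => ?_
        rw [hsplit]
        have h3 := norm_add_le (trigFun F₁ c (v (x + y * I))) (trigFun F₂ c (v (x + y * I)))
        have h4 : ‖trigFun F₁ c (v (x + y * I)) + trigFun F₂ c (v (x + y * I))‖ ^ 2 ≤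
            2 * ‖trigFun F₁ c (v (x + y * I))‖ ^ 2 + 2 * ‖trigFun F₂ c (v (x + y * I))‖ ^ 2 := by
          refine (pow_le_pow_left₀ (norm_nonneg _) h3 2).trans ?_
          nlinarith [sq_nonneg (‖trigFun F₁ c (v (x + y * I))‖ - ‖trigFun F₂ c (v (x + y * I))‖)]
        refine (mul_le_mul_of_nonneg_left h4 (norm_nonneg _)).trans (le_of_eq ?_)
        ring
    _ ≤ _ := by
        rw [intervalIntegral.integral_add ((hi2 F₁).intervalIntegrable _ _)
          ((hi2 F₂).intervalIntegrable _ _),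
          intervalIntegral.integral_const_mul, intervalIntegral.integral_const_mul, ← hsum]
        linarith

/-- Here `t` is traded for `κt`: on the line of height `-δt` the holomorphic extension `Ψ` of the
conjugate factor has its modes damped by `exp(-|k|t)`, while `v` brings that line within `κt` of the
real axis. -/
lemma norm_integral_conj_trigFun_le_of_sign (h : InverseLift v ζ κ Λ n ε) {δ : ℤ}
    (hδ : δ = 1 ∨ δ = -1) {F : Finset ℤ} (hF : ∀ k ∈ F, 0 ≤ δ * k) (a : ℤ → ℂ) (F' : Finset ℤ)
    (c : ℤ → ℂ) {t : ℝ} (ht : 0 ≤ t) (htζ : t ≤ ζ) (hκ : 0 ≤ κ) :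
    ‖∫ x in (0 : ℝ)..2 * π * n, conj (trigFun F a x) * (deriv v x * trigFun F' c (v x))‖ ≤
      Real.exp (π / 3) * (π * Λ * ∑ k ∈ F, ‖a k‖ ^ 2 / Real.cosh (2 * k * t) +
        Real.exp (π / 3) * (8 * π * ∑ k ∈ F', Real.cosh (2 * k * (κ * t)) * ‖c k‖ ^ 2)) := by
  -- A negative `Λ` would force `v' = 0` on the real line, against its total mass `2π`.
  have hΛ : 0 ≤ Λ := by
    by_contra h2
    have h3 : ∀ x : ℝ, ‖deriv v x‖ ≤ 0 := fun x => by
      have := h.distortion x x (by simpa using Real.two_pi_pos.le)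
      nlinarith [norm_nonneg (deriv v x)]
    have h4 := h.integral_weight
    have h5 : ∀ x : ℝ, ‖deriv v x‖ = 0 := fun x => le_antisymm (h3 x) (norm_nonneg _)
    simp only [h5, intervalIntegral.integral_zero] at h4
    linarith [Real.two_pi_pos]
  have hδ1 : |(δ : ℝ)| = 1 := by rcases hδ with rfl | rfl <;> simp
  -- The sign is such that `|exp(-ik(x + iy))| = exp(ky) = exp(-|k|t)` whenever `δk ≥ 0`.
  set y : ℝ := -(δ * t) with hydef
  have hyt : |y| = t := by rw [hydef, abs_neg, abs_mul, hδ1, one_mul, abs_of_nonneg ht]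
  have hy : |y| ≤ ζ := hyt.trans_le htζ
  have h0 : |(0 : ℝ)| ≤ ζ := by simpa using h.zeta_pos.le
  set Ψ : ℂ → ℂ := fun z => ∑ k ∈ F, conj (a k) * exp (-(k * z * I)) with hΨ
  have hΨd : Differentiable ℂ Ψ := by rw [hΨ]; fun_prop
  have hΨconj : ∀ z, Ψ z = conj (trigFun F a (conj z)) := by
    intro z
    rw [hΨ, trigFun, map_sum]
    refine Finset.sum_congr rfl fun k _ => ?_
    rw [map_mul, ← exp_conj]
    simp
  have hΨper : ∀ z, Ψ (z + (2 * π * n : ℝ)) = Ψ z := by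
    intro z
    refine Finset.sum_congr rfl fun k _ => ?_
    congr 1
    rw [show (-(k * (z + (2 * π * n : ℝ)) * I) : ℂ) =
      -(k * z * I) + ((-(k * n) : ℤ) : ℂ) * (2 * π * I) by push_cast; ring, exp_add,
      exp_int_mul_two_pi_mul_I, mul_one]
  have hψper : ∀ z ∈ closedStrip ζ,
      trigFun F' c (v (z + (2 * π * n : ℝ))) = trigFun F' c (v z) := by
    intro z hz
    rw [h.add_period z hz]
    rcases h.sign with rfl | rfl
    · simp [trigFun_add_two_pi]
    · rw [← trigFun_add_two_pi]; simp
  have e1 : ∫ x in (0 : ℝ)..2 * π * n, conj (trigFun F a x) * (deriv v x * trigFun F' c (v x)) =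
      ∫ x in (0 : ℝ)..2 * π * n, Ψ (x + y * I) *
        (deriv v (x + y * I) * trigFun F' c (v (x + y * I))) := by
    have h1 := integral_line_eq (p := 2 * π * n) (y₁ := 0) (y₂ := y)
      (Φ := fun z => Ψ z * (deriv v z * trigFun F' c (v z)))
      (fun z hz => by
        have hz' := mem_closedStrip_of_uIcc h0 hy hz
        rw [hΨper, h.deriv_add_period z hz', hψper z hz'])
      (fun z hz => by
        have hz' := mem_closedStrip_of_uIcc h0 hy hz
        exact (hΨd z).mul ((h.analytic.deriv z hz').differentiableAt.mul
          ((differentiable_trigFun F' c _).comp z (h.analytic z hz').differentiableAt)))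
    rw [← h1]
    simp [hΨconj]
  have hcv := h.continuous_comp_line hy
  have hi1 : Continuous fun x : ℝ => ‖deriv v x‖ * ‖trigFun F a (x + (-y : ℝ) * I)‖ ^ 2 :=
    h.continuous_weight.mul
      (((differentiable_trigFun F a).continuous.comp (by fun_prop)).norm.pow 2)
  have hi2 : Continuous fun x : ℝ => ‖deriv v x‖ * ‖trigFun F' c (v (x + y * I))‖ ^ 2 :=
    h.continuous_weight.mul (((differentiable_trigFun F' c).continuous.comp hcv).norm.pow 2)
  have e2 : ∫ x in (0 : ℝ)..2 * π * n, ‖deriv v x‖ * ‖trigFun F a (x + (-y : ℝ) * I)‖ ^ 2 ≤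
      Λ * (2 * π * ∑ k ∈ F, ‖a k‖ ^ 2 / Real.cosh (2 * k * t)) := by
    have h1 := h.integral_weight_mul_le
      (q := fun x : ℝ => ‖trigFun F a (x + (-y : ℝ) * I)‖ ^ 2)
      (((differentiable_trigFun F a).continuous.comp (by fun_prop)).norm.pow 2)
      (fun x => sq_nonneg _) (fun x => by
        simp only
        rw [← trigFun_add_two_pi F a (x + (-y : ℝ) * I)]
        push_cast
        rw [add_right_comm])
    refine h1.trans (mul_le_mul_of_nonneg_left ?_ hΛ)
    rw [integral_norm_sq_trigFun]
    refine mul_le_mul_of_nonneg_left (Finset.sum_le_sum fun k hk => ?_) Real.two_pi_pos.le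
    rw [div_eq_mul_inv]
    refine mul_le_mul_of_nonneg_left ?_ (sq_nonneg _)
    have h2 : (0 : ℝ) ≤ δ * k := by exact_mod_cast hF k hk
    have h3 : Real.cosh (2 * k * t) = Real.cosh (2 * k * -y) := by
      rw [hydef]
      rcases hδ with rfl | rfl
      · simp
      · rw [← Real.cosh_neg]; simp
    rw [h3, Real.exp_neg]
    -- As `cosh u ≤ exp u` for `u ≥ 0`, the damping `exp(-2|k|t)` is at most `1 / cosh 2kt`.
    refine inv_anti₀ (Real.cosh_pos _) ?_
    have h4 : 0 ≤ 2 * k * -y := by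
      rw [hydef]
      nlinarith
    rw [Real.cosh_eq]
    have h5 : Real.exp (-(2 * k * -y)) ≤ Real.exp (2 * k * -y) :=
      Real.exp_le_exp.2 (by linarith)
    linarith
  have e3 := h.integral_weight_mul_trigFun_le F' c hy (s := κ * t) (by rw [hyt])
    (mul_nonneg hκ ht)
  rw [e1]
  calc _ ≤ ∫ x in (0 : ℝ)..2 * π * n, Real.exp (π / 3) / 2 *
        (‖deriv v x‖ * ‖trigFun F a (x + (-y : ℝ) * I)‖ ^ 2 +
          ‖deriv v x‖ * ‖trigFun F' c (v (x + y * I))‖ ^ 2) := by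
        refine intervalIntegral.norm_integral_le_of_norm_le (by positivity)
          (Filter.Eventually.of_forall fun x _ => ?_)
          ((continuous_const.mul (hi1.add hi2)).intervalIntegrable _ _)
        have h1 : conj (x + y * I : ℂ) = x + (-y : ℝ) * I := by simp
        rw [hΨconj, h1, norm_mul, RCLike.norm_conj, norm_mul]
        have h2 := h.norm_deriv_line_le hy x
        set A := ‖trigFun F a (x + (-y : ℝ) * I)‖
        set B := ‖trigFun F' c (v (x + y * I))‖
        -- This stands in for Cauchy–Schwarz; the product form is recovered by scaling in
        -- `le_two_mul_of_forall_scaling`.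
        have hAB : A * B ≤ (A ^ 2 + B ^ 2) / 2 := by nlinarith [sq_nonneg (A - B)]
        have hA : 0 ≤ A := norm_nonneg _
        have hB : 0 ≤ B := norm_nonneg _
        calc _ = ‖deriv v (x + y * I)‖ * (A * B) := by ring
          _ ≤ (Real.exp (π / 3) * ‖deriv v x‖) * ((A ^ 2 + B ^ 2) / 2) :=
            mul_le_mul h2 hAB (by positivity) (by positivity)
          _ = _ := by ring
    _ ≤ _ := by
        rw [intervalIntegral.integral_const_mul, intervalIntegral.integral_add
          (hi1.intervalIntegrable _ _) (hi2.intervalIntegrable _ _),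
          div_mul_eq_mul_div, mul_div_assoc]
        refine mul_le_mul_of_nonneg_left ?_ (Real.exp_pos _).le
        linarith

/-- Only the first factor is split by sign, so the sum over `F'` is counted twice and `8π` becomes
`16π`. -/
lemma norm_integral_conj_trigFun_le (h : InverseLift v ζ κ Λ n ε) (F : Finset ℤ) (a : ℤ → ℂ)
    (F' : Finset ℤ) (c : ℤ → ℂ) {t : ℝ} (ht : 0 ≤ t) (htζ : t ≤ ζ) (hκ : 0 ≤ κ) :
    ‖∫ x in (0 : ℝ)..2 * π * n, conj (trigFun F a x) * (deriv v x * trigFun F' c (v x))‖ ≤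
      Real.exp (π / 3) * (π * Λ * ∑ k ∈ F, ‖a k‖ ^ 2 / Real.cosh (2 * k * t) +
        Real.exp (π / 3) * (16 * π * ∑ k ∈ F', Real.cosh (2 * k * (κ * t)) * ‖c k‖ ^ 2)) := by
  set F₁ := F.filter fun k => 0 ≤ k
  set F₂ := F.filter fun k => ¬ 0 ≤ k
  have h1 := h.norm_integral_conj_trigFun_le_of_sign (δ := 1) (Or.inl rfl) (F := F₁)
    (fun k hk => by simpa using (Finset.mem_filter.1 hk).2) a F' c ht htζ hκ
  have h2 := h.norm_integral_conj_trigFun_le_of_sign (δ := -1) (Or.inr rfl) (F := F₂)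
    (fun k hk => by have := (Finset.mem_filter.1 hk).2; linarith) a F' c ht htζ hκ
  have hsplit : ∀ z, trigFun F a z = trigFun F₁ a z + trigFun F₂ a z := fun z =>
    (Finset.sum_filter_add_sum_filter_not F _ _).symm
  have hsum := Finset.sum_filter_add_sum_filter_not F (fun k => 0 ≤ k)
    fun k : ℤ => ‖a k‖ ^ 2 / Real.cosh (2 * k * t)
  have hcv : Continuous fun x : ℝ => v x :=
    continuous_iff_continuousAt.2 fun x => (h.hasDerivAt_line x).continuousAt
  have hi : ∀ F : Finset ℤ, Continuous fun x : ℝ =>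
      conj (trigFun F a x) * (deriv v x * trigFun F' c (v x)) := fun F =>
    (continuous_conj.comp ((differentiable_trigFun F a).continuous.comp continuous_ofReal)).mul
      (h.continuous_deriv.mul ((differentiable_trigFun F' c).continuous.comp hcv))
  simp only [hsplit, map_add, add_mul]
  rw [intervalIntegral.integral_add ((hi F₁).intervalIntegrable _ _)
    ((hi F₂).intervalIntegrable _ _), ← hsum]
  refine (norm_add_le _ _).trans ((add_le_add h1 h2).trans (le_of_eq ?_))
  ring

end InverseLift

/-! ### The Koopman operator -/

/-- A trigonometric polynomial as a continuous function on the torus. -/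
noncomputable def trigC (F : Finset ℤ) (c : ℤ → ℂ) : C(Torus, ℂ) := ∑ k ∈ F, c k • fourier k

lemma trigC_coe (F : Finset ℤ) (c : ℤ → ℂ) (x : ℝ) : trigC F c (x : Torus) = trigFun F c x := by
  rw [trigC, trigFun, ContinuousMap.coe_sum, Finset.sum_apply]
  refine Finset.sum_congr rfl fun k _ => ?_
  rw [ContinuousMap.smul_apply, fourier_coe_apply, smul_eq_mul]
  congr 2
  push_cast
  field_simp

lemma memLp_of_continuous (g : C(Torus, ℂ)) (μ : Measure Torus) [IsFiniteMeasure μ] :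
    MemLp g 2 μ :=
  MemLp.of_bound g.continuous.aestronglyMeasurable ‖g‖
    (Filter.Eventually.of_forall g.norm_coe_le_norm)

lemma toLp_trigC (F : Finset ℤ) (c : ℤ → ℂ) :
    (memLp_of_continuous (trigC F c) AddCircle.haarAddCircle).toLp _ = trigSum F c := by
  have h1 : (memLp_of_continuous (trigC F c) AddCircle.haarAddCircle).toLp _ =
      ContinuousMap.toLp (E := ℂ) 2 AddCircle.haarAddCircle ℂ (trigC F c) := rfl
  rw [h1, trigC, map_sum]
  exact Finset.sum_congr rfl fun k _ => map_smul _ _ _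

lemma integral_haar_eq (q : Torus → ℂ) :
    ∫ θ, q θ ∂AddCircle.haarAddCircle = (2 * π : ℂ)⁻¹ * ∫ x in (0 : ℝ)..2 * π, q (x : Torus) := by
  rw [AddCircle.integral_haarAddCircle, ← AddCircle.intervalIntegral_preimage (2 * π) 0, zero_add,
    Complex.real_smul]
  push_cast
  rfl

lemma inner_toLp {φ ψ : Torus → ℂ} (hφ : MemLp φ 2 (AddCircle.haarAddCircle : Measure Torus))
    (hψ : MemLp ψ 2 (AddCircle.haarAddCircle : Measure Torus)) :
    inner ℂ (hφ.toLp φ) (hψ.toLp ψ) =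
      (2 * π : ℂ)⁻¹ * ∫ x in (0 : ℝ)..2 * π, conj (φ (x : Torus)) * ψ (x : Torus) := by
  rw [L2.inner_def, ← integral_haar_eq (fun θ => conj (φ θ) * ψ θ)]
  refine integral_congr_ae ?_
  filter_upwards [hφ.coeFn_toLp, hψ.coeFn_toLp] with θ h1 h2
  rw [h1, h2, RCLike.inner_apply, mul_comm]

/-- `A` is covered by `2N` periods, each containing one copy of `B`. -/
lemma volume_preimage_inter_le (B : Set Torus) (hB : MeasurableSet B) {A : Set ℝ} {N : ℕ}
    (hA : A ⊆ Set.Ioc (-(2 * π * N)) (2 * π * N)) :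
    volume (A ∩ (fun x : ℝ => (x : Torus)) ⁻¹' B) ≤ (2 * N : ℕ) * volume B := by
  have h1 : A ∩ (fun x : ℝ => (x : Torus)) ⁻¹' B ⊆ ⋃ j ∈ Finset.range (2 * N),
      (fun x : ℝ => (x : Torus)) ⁻¹' B ∩
        Set.Ioc (2 * π * (j - N : ℝ)) (2 * π * (j - N : ℝ) + 2 * π) := by
    rintro x ⟨hx, hxB⟩
    obtain ⟨h1, h2⟩ := hA hx
    have hp := Real.two_pi_pos
    have h3 := Int.ceil_lt_add_one (x / (2 * π))
    have h4 := Int.le_ceil (x / (2 * π))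
    -- The ceiling matches periods that are open on the left.
    set m := ⌈x / (2 * π)⌉
    rw [div_le_iff₀ hp] at h4
    rw [← sub_lt_iff_lt_add, lt_div_iff₀ hp] at h3
    have h5 : 0 ≤ m - 1 + N := by
      by_contra h5
      have : (m : ℝ) ≤ -N := by exact_mod_cast (by linarith : m ≤ -N)
      nlinarith
    have h6 : m - 1 + N < (2 * N : ℕ) := by
      by_contra h6
      have : (N : ℝ) ≤ m - 1 := by
        push_cast at h6
        exact_mod_cast (by linarith : (N : ℤ) ≤ m - 1)
      nlinarith
    obtain ⟨j, hj⟩ := Int.eq_ofNat_of_zero_le h5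
    have hj' : (j : ℝ) - N = m - 1 := by
      have : (m : ℝ) - 1 + N = j := by exact_mod_cast hj
      linarith
    simp only [Set.mem_iUnion]
    refine ⟨j, Finset.mem_range.2 (by omega), hxB, ?_⟩
    rw [hj']
    exact ⟨by linarith, by linarith⟩
  refine (measure_mono h1).trans ((measure_biUnion_finset_le _ _).trans ?_)
  have h2 : ∀ a : ℝ, volume ((fun x : ℝ => (x : Torus)) ⁻¹' B ∩ Set.Ioc a (a + 2 * π)) =
      volume B := by
    intro a
    have h3 := (AddCircle.measurePreserving_mk (2 * π) a).measure_preimage hB.nullMeasurableSet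
    rw [Measure.restrict_apply (AddCircle.measurable_mk' hB)] at h3
    exact h3
  simp only [h2]
  simp

section

variable {f : Torus → Torus} {ζ κ : ℝ} {α D : ℝ≥0}

lemma IsExpanding.continuous (h : IsExpanding f ζ κ α D) : Continuous f := by
  obtain ⟨g, v, hg, -⟩ := h.exists_inverse_lift
  rw [(QuotientAddGroup.isOpenQuotientMap_mk (N := AddSubgroup.zmultiples
    (2 * π))).isQuotientMap.continuous_iff]
  have : f ∘ (QuotientAddGroup.mk : ℝ → Torus) = fun x => ((g x : ℝ) : Torus) :=
    funext fun x => (hg x).symm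
  rw [this]
  exact (AddCircle.continuous_mk' (2 * π)).comp g.continuous

/-- Over a period, `f⁻¹ B` lies in the image of at most `2N` copies of `B` under the inverse lift,
which does not increase length. The number `N` depends on `f`, but serves only to define the
operator on `L²`. -/
lemma IsExpanding.exists_map_le (hζ : 0 < ζ) (h : IsExpanding f ζ κ α D) :
    ∃ N : ℕ, Measure.map f AddCircle.haarAddCircle ≤
      (N : ℝ≥0∞) • (AddCircle.haarAddCircle : Measure Torus) := by
  obtain ⟨g, v, n, ε, hg, hv, hκ, hκ0, hv'⟩ := h.exists_inverseLift hζ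
  have hlip : LipschitzWith 1 g.symm := by
    refine LipschitzWith.of_dist_le_mul fun x y => ?_
    have h1 := (convex_closedStrip ζ).norm_image_sub_le_of_norm_deriv_le
      (fun z hz => (hv'.analytic z hz).differentiableAt) hκ (ofReal_mem_closedStrip hζ y)
      (ofReal_mem_closedStrip hζ x)
    rw [hv, hv, ← ofReal_sub, ← ofReal_sub, Complex.norm_real, Complex.norm_real] at h1
    rw [dist_eq_norm, dist_eq_norm, NNReal.coe_one]
    exact h1.trans (mul_le_mul_of_nonneg_right h.kappa_lt_one.le (norm_nonneg _))
  have hbdd : ∃ N : ℕ, g '' Set.Ioc 0 (0 + 2 * π) ⊆ Set.Ioc (-(2 * π * N)) (2 * π * N) := by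
    obtain ⟨R, hR⟩ := (isCompact_Icc (a := (0 : ℝ)) (b := 0 + 2 * π)).exists_bound_of_continuousOn
      g.continuous.continuousOn
    obtain ⟨N, hN⟩ := exists_nat_gt R
    refine ⟨N, ?_⟩
    rintro _ ⟨x, hx, rfl⟩
    have h1 := abs_le.1 (hR x (Set.Ioc_subset_Icc_self hx))
    have h2 : (N : ℝ) ≤ 2 * π * N := by
      have := Real.pi_gt_three
      nlinarith [(Nat.cast_nonneg N : (0 : ℝ) ≤ N)]
    exact ⟨by linarith [h1.1], by linarith [h1.2]⟩
  obtain ⟨N, hN⟩ := hbdd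
  have hvol : ∀ B : Set Torus, MeasurableSet B →
      volume (f ⁻¹' B) ≤ (2 * N : ℕ) * volume B := by
    intro B hB
    have hfB := h.continuous.measurable hB
    rw [← (AddCircle.measurePreserving_mk (2 * π) 0).measure_preimage hfB.nullMeasurableSet,
      Measure.restrict_apply (AddCircle.measurable_mk' hfB)]
    have h1 : (fun x : ℝ => (x : Torus)) ⁻¹' (f ⁻¹' B) ∩ Set.Ioc 0 (0 + 2 * π) ⊆
        g.symm '' (g '' Set.Ioc 0 (0 + 2 * π) ∩ (fun x : ℝ => (x : Torus)) ⁻¹' B) := by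
      rintro x ⟨hx1, hx2⟩
      refine ⟨g x, ⟨⟨x, hx2, rfl⟩, ?_⟩, g.symm_apply_apply x⟩
      simpa [hg] using hx1
    refine (measure_mono h1).trans (le_trans ?_ (volume_preimage_inter_le B hB hN))
    -- Length is one-dimensional Hausdorff measure, which a 1-Lipschitz map does not increase.
    have h2 := hlip.hausdorffMeasure_image_le (d := 1) zero_le_one
      (g '' Set.Ioc 0 (0 + 2 * π) ∩ (fun x : ℝ => (x : Torus)) ⁻¹' B)
    rw [hausdorffMeasure_real] at h2
    simpa using h2
  refine ⟨2 * N, Measure.le_iff.2 fun B hB => ?_⟩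
  rw [Measure.map_apply h.continuous.measurable hB, Measure.smul_apply, smul_eq_mul]
  have h1 := hvol B hB
  rw [AddCircle.volume_eq_smul_haarAddCircle, Measure.smul_apply, Measure.smul_apply, smul_eq_mul,
    smul_eq_mul, mul_left_comm] at h1
  exact (ENNReal.mul_le_mul_iff_right (by simp [Real.pi_pos]) ENNReal.ofReal_ne_top).1 h1

/-- Nonsingularity of `f` makes composition well defined on almost-everywhere classes. The `L²`
continuity is used later to pass to limits of trigonometric polynomials. -/
lemma IsExpanding.exists_koopman (hζ : 0 < ζ) (h : IsExpanding f ζ κ α D) :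
    ∃ S : TorusL2 →L[ℂ] TorusL2, ∀ (φ : Torus → ℂ)
      (hφ : MemLp φ 2 (AddCircle.haarAddCircle : Measure Torus)),
      ∃ hT : MemLp (koopman f φ) 2 (AddCircle.haarAddCircle : Measure Torus),
        S (hφ.toLp φ) = hT.toLp (koopman f φ) := by
  obtain ⟨N, hN⟩ := h.exists_map_le hζ
  have hf := h.continuous.measurable
  have hq : Measure.QuasiMeasurePreserving f AddCircle.haarAddCircle AddCircle.haarAddCircle :=
    ⟨hf, Measure.absolutelyContinuous_of_le_smul hN⟩
  have hmem : ∀ φ : Torus → ℂ, MemLp φ 2 (AddCircle.haarAddCircle : Measure Torus) →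
      MemLp (koopman f φ) 2 (AddCircle.haarAddCircle : Measure Torus) := fun φ hφ =>
    (hφ.of_measure_le_smul (ENNReal.natCast_ne_top N) hN).comp_of_map hf.aemeasurable
  have hcongr : ∀ {φ ψ : Torus → ℂ}, φ =ᵐ[AddCircle.haarAddCircle] ψ →
      koopman f φ =ᵐ[AddCircle.haarAddCircle] koopman f ψ := fun hφψ => hq.ae_eq_comp hφψ
  let S₀ : TorusL2 →ₗ[ℂ] TorusL2 :=
    { toFun := fun φ => (hmem φ (Lp.memLp φ)).toLp _
      map_add' := fun φ ψ => by
        have h1 := hcongr (Lp.coeFn_add φ ψ)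
        exact (MemLp.toLp_congr _ ((hmem φ (Lp.memLp φ)).add (hmem ψ (Lp.memLp ψ))) h1).trans
          (MemLp.toLp_add _ _)
      map_smul' := fun c φ => by
        have h1 := hcongr (Lp.coeFn_smul c φ)
        exact (MemLp.toLp_congr _ ((hmem φ (Lp.memLp φ)).const_smul c) h1).trans
          (MemLp.toLp_const_smul c _) }
  have hbound : ∀ φ, ‖S₀ φ‖ ≤ (N : ℝ) ^ (1 / 2 : ℝ) * ‖φ‖ := by
    intro φ
    change ‖(hmem φ (Lp.memLp φ)).toLp _‖ ≤ _
    rw [Lp.norm_toLp, Lp.norm_def]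
    have h1 : eLpNorm (koopman f φ) 2 AddCircle.haarAddCircle =
        eLpNorm φ 2 (Measure.map f AddCircle.haarAddCircle) :=
      (eLpNorm_map_measure ((Lp.memLp φ).of_measure_le_smul (ENNReal.natCast_ne_top N)
        hN).aestronglyMeasurable hf.aemeasurable).symm
    have h2 := eLpNorm_mono_measure φ hN (p := 2)
    rw [eLpNorm_smul_measure_of_ne_top (by norm_num), ← h1, smul_eq_mul] at h2
    have h3 := ENNReal.toReal_mono (ENNReal.mul_ne_top (ENNReal.rpow_ne_top_of_nonneg
      (by positivity) (ENNReal.natCast_ne_top N)) (Lp.memLp φ).2.ne) h2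
    rw [ENNReal.toReal_mul, ← ENNReal.toReal_rpow] at h3
    simpa using h3
  refine ⟨S₀.mkContinuous _ hbound, fun φ hφ => ⟨hmem φ hφ, ?_⟩⟩
  have h1 := hcongr hφ.coeFn_toLp
  exact MemLp.toLp_congr (hmem _ (Lp.memLp (hφ.toLp φ))) (hmem φ hφ) h1

end

/-- The norm bound for Koopman operators, in terms of the distortion. -/
noncomputable def koopmanConst (D : ℝ) : ℝ :=
  Real.exp (π / 3) * (Real.exp (7 * D) + 16 * Real.exp (π / 3))

lemma koopmanConst_pos (D : ℝ) : 0 < koopmanConst D := by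
  unfold koopmanConst
  positivity

/-- The choice `r = 1/b` is optimal; for `b = 0`, a large `r` rules out `a > 0`. -/
lemma le_two_mul_of_forall_scaling {a b c : ℝ} (hb : 0 ≤ b) (hc : 0 ≤ c)
    (h : ∀ r : ℝ, 0 < r → r * a ≤ c * ((r * b) ^ 2 + 1)) : a ≤ 2 * c * b := by
  rcases hb.eq_or_lt with rfl | hb
  · simp only [mul_zero]
    by_contra ha
    rw [not_le] at ha
    have h1 := h ((c + 1) / a) (by positivity)
    rw [div_mul_cancel₀ _ ha.ne'] at h1
    simp at h1
    linarith
  · have h1 := h b⁻¹ (by positivity)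
    rw [inv_mul_cancel₀ hb.ne', inv_mul_le_iff₀ hb] at h1
    linarith

section

variable {f : Torus → Torus} {ζ κ : ℝ} {α D : ℝ≥0}

/-- Substitution `x = g⁻¹(y)`. The endpoints differ by `2πε`, and the factor `ε` undoes the reversal
of orientation. -/
lemma InverseLift.integral_comp {v : ℂ → ℂ} {Λ : ℝ} {n : ℕ} {ε : ℝ} (h : InverseLift v ζ κ Λ n ε)
    {g : ℝ ≃ₜ ℝ} (hv : ∀ y : ℝ, v y = (g.symm y : ℝ)) {Q : ℝ → ℂ} (hQ : Continuous Q)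
    (hper : Function.Periodic Q (2 * π)) :
    ∫ x in (0 : ℝ)..2 * π, Q x = ε * ∫ y in (0 : ℝ)..2 * π * n, deriv v y * Q (g.symm y) := by
  have h1 : ∀ x : ℝ, HasDerivAt g.symm (ε * ‖deriv v x‖) x := by
    intro x
    have h2 := (h.analytic _ (ofReal_mem_closedStrip h.zeta_pos x)).differentiableAt.hasDerivAt
    rw [h.deriv_real, ← ofReal_mul] at h2
    simpa [hv] using h2.real_of_complex
  have h3 := intervalIntegral.integral_deriv_smul_comp (a := 0) (b := 2 * π * n)
    (f := g.symm) (f' := fun x : ℝ => ε * ‖deriv v x‖) (g := Q) (fun x _ => h1 x)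
    (continuous_const.mul h.continuous_weight).continuousOn hQ
  have h4 : g.symm (2 * π * n) = g.symm 0 + 2 * π * ε := by
    have := h.apply_period
    rw [hv, hv] at this
    exact_mod_cast this
  have h5 : ∀ x : ℝ, (ε * ‖deriv v x‖) • (Q ∘ g.symm) x = deriv v x * Q (g.symm x) := by
    intro x
    rw [Complex.real_smul, ofReal_mul, ← h.deriv_real]
    rfl
  simp only [h5] at h3
  rw [h3, h4]
  have h6 := hper.intervalIntegral_add_eq 0 (g.symm 0)
  rw [zero_add] at h6
  rcases h.sign with rfl | rfl
  · rw [h6]; simp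
  · have h7 := hper.intervalIntegral_add_eq (g.symm 0) (g.symm 0 - 2 * π)
    rw [h6, h7, intervalIntegral.integral_symm]
    simp [← sub_eq_add_neg]

/-- The Koopman operator maps `H²_{-t}` to `H²_{-κt}`. -/
lemma IsExpanding.dualNorm_koopman_le (hζ : 0 < ζ) (h : IsExpanding f ζ κ α D)
    {S : TorusL2 →L[ℂ] TorusL2} (hS : ∀ (φ : Torus → ℂ)
      (hφ : MemLp φ 2 (AddCircle.haarAddCircle : Measure Torus)),
      ∃ hT : MemLp (koopman f φ) 2 (AddCircle.haarAddCircle : Measure Torus),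
        S (hφ.toLp φ) = hT.toLp (koopman f φ))
    {t : ℝ} (ht : 0 < t) (htζ : t ≤ ζ) (φ : TorusL2) :
    dualNorm (κ * t) (S φ) ≤ koopmanConst D * dualNorm t φ := by
  obtain ⟨g, v, n, ε, hg, hv, hκ, hκ0, hv'⟩ := h.exists_inverseLift hζ
  have hfc := h.continuous
  -- the estimate for trigonometric polynomials
  have key : ∀ (F : Finset ℤ) (a : ℤ → ℂ) (F' : Finset ℤ) (c : ℤ → ℂ),
      ‖inner ℂ (S (trigSum F a)) (trigSum F' c)‖ ≤ koopmanConst D / 2 *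
        (∑ k ∈ F, ‖a k‖ ^ 2 / Real.cosh (2 * k * t) +
          ∑ k ∈ F', Real.cosh (2 * k * (κ * t)) * ‖c k‖ ^ 2) := by
    intro F a F' c
    rw [← toLp_trigC, ← toLp_trigC]
    obtain ⟨hT, hST⟩ := hS (trigC F a) (memLp_of_continuous _ _)
    rw [hST, inner_toLp]
    have e1 := hv'.integral_comp hv
      (Q := fun x => conj (koopman f (trigC F a) (x : Torus)) * trigC F' c (x : Torus))
      (by
        have h1 : Continuous fun x : ℝ => (x : Torus) := AddCircle.continuous_mk' (2 * π)
        exact (continuous_conj.comp ((trigC F a).continuous.comp (hfc.comp h1))).mul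
          ((trigC F' c).continuous.comp h1))
      (fun x => by simp only [AddCircle.coe_add_period])
    rw [e1]
    have e2 : ∀ y : ℝ, deriv v y * (conj (koopman f (trigC F a) (g.symm y : Torus)) *
        trigC F' c (g.symm y : Torus)) =
          conj (trigFun F a y) * (deriv v y * trigFun F' c (v y)) := by
      intro y
      rw [koopman, ← hg, g.apply_symm_apply, trigC_coe, trigC_coe, hv]
      ring
    simp only [e2]
    have e3 := hv'.norm_integral_conj_trigFun_le F a F' c ht.le htζ hκ0.le
    set A := ∑ k ∈ F, ‖a k‖ ^ 2 / Real.cosh (2 * k * t)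
    set B := ∑ k ∈ F', Real.cosh (2 * k * (κ * t)) * ‖c k‖ ^ 2
    have hA : 0 ≤ A := Finset.sum_nonneg fun k _ => div_nonneg (sq_nonneg _) (Real.cosh_pos _).le
    have hB : 0 ≤ B := Finset.sum_nonneg fun k _ => mul_nonneg (Real.cosh_pos _).le (sq_nonneg _)
    have hε : ‖(ε : ℂ)‖ = 1 := by rcases hv'.sign with rfl | rfl <;> simp
    have h2π : ‖(2 * π : ℂ)⁻¹‖ = (2 * π)⁻¹ := by
      rw [norm_inv, norm_mul, Complex.norm_real, Real.norm_eq_abs, abs_of_pos Real.pi_pos]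
      simp
    rw [norm_mul, norm_mul, hε, one_mul, h2π, inv_mul_le_iff₀ Real.two_pi_pos]
    refine e3.trans ?_
    rw [koopmanConst]
    have hE := Real.exp_pos (π / 3)
    have hL := Real.exp_pos (7 * (D : ℝ))
    have hpi := Real.pi_pos
    -- Up to numerical factors, these are the cross terms by which the product in the bound exceeds
    -- the two terms of `e3`.
    have h1 : 0 ≤ π * Real.exp (π / 3) * Real.exp (7 * (D : ℝ)) * B := by positivity
    have h2 : 0 ≤ π * Real.exp (π / 3) * Real.exp (π / 3) * A := by positivity
    nlinarith
  -- density of trigonometric polynomials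
  have key2 : ∀ φ : TorusL2, dualNorm (κ * t) (S φ) ≤
      koopmanConst D / 2 * (dualNorm t φ ^ 2 + 1) := by
    intro φ
    have hC := koopmanConst_pos D
    refine dualNorm_le_of_trigSum (by positivity) fun F' c hc => ?_
    have h1 : Filter.Tendsto (fun F => inner ℂ (S (trigSum F (fourierCoeff φ))) (trigSum F' c))
        Filter.atTop (nhds (inner ℂ (S φ) (trigSum F' c))) :=
      ((S.continuous.tendsto φ).comp (tendsto_trigSum φ)).inner tendsto_const_nhds
    refine le_of_tendsto h1.norm (Filter.Eventually.of_forall fun F => (key _ _ _ _).trans ?_)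
    refine mul_le_mul_of_nonneg_left (add_le_add (sum_div_cosh_le t φ F) hc) (by positivity)
  have h3 := le_two_mul_of_forall_scaling (a := dualNorm (κ * t) (S φ)) (b := dualNorm t φ)
    (c := koopmanConst D / 2) (apply_nonneg _ _) (by linarith [koopmanConst_pos D])
    (fun r hr => by
      have h4 := key2 ((r : ℂ) • φ)
      rwa [map_smul, map_smul_eq_mul, map_smul_eq_mul, Complex.norm_real, Real.norm_eq_abs,
        abs_of_pos hr] at h4)
  linarith

end

/-! ### Multiplication by analytic functions -/

lemma memLp_continuous_mul (u : C(Torus, ℂ)) {ψ : Torus → ℂ} {μ : Measure Torus}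
    (hψ : MemLp ψ 2 μ) : MemLp (fun θ => u θ * ψ θ) 2 μ := by
  refine MemLp.of_le_mul (c := ‖u‖) hψ
    (u.continuous.aestronglyMeasurable.mul hψ.aestronglyMeasurable)
    (Filter.Eventually.of_forall fun θ => ?_)
  rw [norm_mul]
  exact mul_le_mul_of_nonneg_right (u.norm_coe_le_norm θ) (norm_nonneg _)

/-- Multiplication by a continuous function on `L²`. -/
noncomputable def mulL2 (u : C(Torus, ℂ)) : TorusL2 →L[ℂ] TorusL2 :=
  LinearMap.mkContinuous
    { toFun := fun ψ => (memLp_continuous_mul u (Lp.memLp ψ)).toLp _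
      map_add' := fun φ ψ => by
        refine (MemLp.toLp_congr _ ((memLp_continuous_mul u (Lp.memLp φ)).add
          (memLp_continuous_mul u (Lp.memLp ψ))) ?_).trans (MemLp.toLp_add _ _)
        filter_upwards [Lp.coeFn_add φ ψ] with θ h
        simp only [h, Pi.add_apply, mul_add]
      map_smul' := fun c φ => by
        refine (MemLp.toLp_congr _ ((memLp_continuous_mul u (Lp.memLp φ)).const_smul c) ?_).trans
          (MemLp.toLp_const_smul c _)
        filter_upwards [Lp.coeFn_smul c φ] with θ h
        simp only [h, Pi.smul_apply, smul_eq_mul]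
        ring } ‖u‖ (fun ψ => by
      refine Lp.norm_le_mul_norm_of_ae_le_mul ?_
      filter_upwards [(memLp_continuous_mul u (Lp.memLp ψ)).coeFn_toLp] with θ h
      refine (congrArg norm h).trans_le ?_
      rw [norm_mul]
      exact mul_le_mul_of_nonneg_right (u.norm_coe_le_norm θ) (norm_nonneg _))

lemma coeFn_mulL2 (u : C(Torus, ℂ)) (ψ : TorusL2) :
    mulL2 u ψ =ᵐ[AddCircle.haarAddCircle] fun θ => u θ * ψ θ :=
  (memLp_continuous_mul u (Lp.memLp ψ)).coeFn_toLp

lemma mulL2_toLp (u : C(Torus, ℂ)) {ψ : Torus → ℂ}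
    (hψ : MemLp ψ 2 (AddCircle.haarAddCircle : Measure Torus)) :
    mulL2 u (hψ.toLp ψ) = (memLp_continuous_mul u hψ).toLp _ := by
  refine Lp.ext ((coeFn_mulL2 u _).trans ?_)
  filter_upwards [hψ.coeFn_toLp, (memLp_continuous_mul u hψ).coeFn_toLp] with θ h1 h2
  rw [h1, h2]

lemma norm_mulL2_le {u : C(Torus, ℂ)} {B : ℝ} (hu : ∀ θ, ‖u θ‖ ≤ B) (ψ : TorusL2) :
    ‖mulL2 u ψ‖ ≤ B * ‖ψ‖ := by
  refine Lp.norm_le_mul_norm_of_ae_le_mul ?_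
  filter_upwards [coeFn_mulL2 u ψ] with θ h
  rw [h, norm_mul]
  exact mul_le_mul_of_nonneg_right (hu θ) (norm_nonneg _)

/-- By a contour shift the coefficients of the product at height `y` are `exp(-ky) b_k`, so Parseval
there gives the bound with weights `exp(-2ky)`. Averaging `y = r` and `y = -r` yields `cosh`. Both
lines must lie in the open strip, hence `r < ζ`. -/
lemma sum_cosh_mul_trigFun_le {ζ B r : ℝ} {H : ℂ → ℂ} (hH : DifferentiableOn ℂ H (openStrip ζ))
    (hper : ∀ z ∈ openStrip ζ, H (z + 2 * π) = H z) (hB : ∀ z ∈ openStrip ζ, ‖H z‖ ≤ B)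
    (hr : 0 ≤ r) (hrζ : r < ζ) (F : Finset ℤ) (c : ℤ → ℂ) (F' : Finset ℤ) :
    ∑ k ∈ F', Real.cosh (2 * k * r) *
        ‖(2 * π : ℂ)⁻¹ * ∫ x in (0 : ℝ)..2 * π, exp (-(k * x * I)) * (H x * trigFun F c x)‖ ^ 2 ≤
      B ^ 2 * ∑ k ∈ F, Real.cosh (2 * k * r) * ‖c k‖ ^ 2 := by
  set b : ℤ → ℂ := fun k =>
    (2 * π : ℂ)⁻¹ * ∫ x in (0 : ℝ)..2 * π, exp (-(k * x * I)) * (H x * trigFun F c x) with hb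
  have hopen : IsOpen (openStrip ζ) := by
    have : Continuous fun z : ℂ => |z.im| := by fun_prop
    exact isOpen_lt this continuous_const
  have hHd : ∀ z ∈ openStrip ζ, DifferentiableAt ℂ H z := fun z hz =>
    (hH z hz).differentiableAt (hopen.mem_nhds hz)
  have hline : ∀ y : ℝ, |y| < ζ → ∑ k ∈ F', Real.exp (-(2 * k * y)) * ‖b k‖ ^ 2 ≤
      B ^ 2 * ∑ k ∈ F, ‖c k‖ ^ 2 * Real.exp (-(2 * k * y)) := by
    intro y hy
    have hmem : ∀ x : ℝ, (x + y * I : ℂ) ∈ openStrip ζ := fun x => by simpa [openStrip] using hy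
    have hHc : Continuous fun x : ℝ => H (x + y * I) :=
      hH.continuousOn.comp_continuous (by fun_prop) hmem
    have htc : Continuous fun x : ℝ => trigFun F c (x + y * I) :=
      (differentiable_trigFun F c).continuous.comp (by fun_prop)
    have hq : Continuous fun x : ℝ => H (x + y * I) * trigFun F c (x + y * I) := hHc.mul htc
    have h0 : |(0 : ℝ)| < ζ := by rw [abs_zero]; exact (abs_nonneg y).trans_lt hy
    have h1 : ∀ k : ℤ, (2 * π : ℂ)⁻¹ * ∫ x in (0 : ℝ)..2 * π,
        exp (-(k * x * I)) * (H (x + y * I) * trigFun F c (x + y * I)) =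
          Real.exp (-(k * y)) * b k := by
      intro k
      have hz' : ∀ z : ℂ, z.im ∈ Set.uIcc 0 y → z ∈ openStrip ζ := fun z hz =>
        abs_lt.2 ((Set.ordConnected_Ioo.uIcc_subset (abs_lt.1 h0) (abs_lt.1 hy)) hz)
      have h2 := integral_line_eq (p := 2 * π) (y₁ := 0) (y₂ := y)
        (Φ := fun z => exp (-(k * z * I)) * (H z * trigFun F c z))
        (fun z hz => by
          push_cast
          rw [hper z (hz' z hz), trigFun_add_two_pi, exp_neg, exp_neg, exp_int_mul_add_two_pi])
        (fun z hz => DifferentiableAt.mul (by fun_prop) ((hHd z (hz' z hz)).mul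
          (differentiable_trigFun F c z)))
      simp only [ofReal_zero, zero_mul, add_zero] at h2
      have h3 : ∀ x : ℝ, exp (-(k * x * I)) * (H (x + y * I) * trigFun F c (x + y * I)) =
          (Real.exp (-(k * y)) : ℂ) *
            (exp (-(k * (x + y * I) * I)) * (H (x + y * I) * trigFun F c (x + y * I))) := by
        intro x
        rw [← mul_assoc (Real.exp _ : ℂ), ofReal_exp, ← exp_add]
        congr 2
        push_cast
        linear_combination (k * y : ℂ) * I_sq
      simp only [h3]
      rw [intervalIntegral.integral_const_mul, mul_left_comm, ← h2]
    have h3 := hasSum_parseval hq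
    simp only [h1] at h3
    have h4 := sum_le_hasSum F' (fun k _ => sq_nonneg _) h3
    have h5 : (2 * π)⁻¹ * ∫ x in (0 : ℝ)..2 * π, ‖H (x + y * I) * trigFun F c (x + y * I)‖ ^ 2 ≤
        B ^ 2 * ∑ k ∈ F, ‖c k‖ ^ 2 * Real.exp (-(2 * k * y)) := by
      have h6 : ∫ x in (0 : ℝ)..2 * π, ‖H (x + y * I) * trigFun F c (x + y * I)‖ ^ 2 ≤
          ∫ x in (0 : ℝ)..2 * π, B ^ 2 * ‖trigFun F c (x + y * I)‖ ^ 2 := by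
        refine intervalIntegral.integral_mono_on Real.two_pi_pos.le
          ((hq.norm.pow 2).intervalIntegrable _ _)
          ((continuous_const.mul (htc.norm.pow 2)).intervalIntegrable _ _) fun x _ => ?_
        rw [norm_mul, mul_pow]
        exact mul_le_mul_of_nonneg_right (pow_le_pow_left₀ (norm_nonneg _) (hB _ (hmem x)) 2)
          (sq_nonneg _)
      rw [intervalIntegral.integral_const_mul, integral_norm_sq_trigFun] at h6
      rw [inv_mul_le_iff₀ Real.two_pi_pos]
      linarith
    refine le_trans (le_of_eq (Finset.sum_congr rfl fun k _ => ?_)) (h4.trans h5)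
    rw [norm_mul (Real.exp _ : ℂ) (b k), Complex.norm_real, Real.norm_eq_abs, Real.abs_exp, mul_pow,
      ← Real.exp_nat_mul]
    congr 2
    push_cast; ring
  have h1 := hline r (by rwa [abs_of_nonneg hr])
  have h2 := hline (-r) (by rwa [abs_neg, abs_of_nonneg hr])
  have e1 : ∀ k : ℤ, Real.cosh (2 * k * r) =
      (Real.exp (-(2 * k * r)) + Real.exp (-(2 * k * -r))) / 2 := by
    intro k
    rw [Real.cosh_eq]
    ring_nf
  have e2 : ∑ k ∈ F', Real.cosh (2 * k * r) * ‖b k‖ ^ 2 =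
      (∑ k ∈ F', Real.exp (-(2 * k * r)) * ‖b k‖ ^ 2 +
        ∑ k ∈ F', Real.exp (-(2 * k * -r)) * ‖b k‖ ^ 2) / 2 := by
    rw [← Finset.sum_add_distrib, Finset.sum_div]
    refine Finset.sum_congr rfl fun k _ => ?_
    rw [e1]; ring
  have e3 : ∑ k ∈ F, Real.cosh (2 * k * r) * ‖c k‖ ^ 2 =
      (∑ k ∈ F, ‖c k‖ ^ 2 * Real.exp (-(2 * k * r)) +
        ∑ k ∈ F, ‖c k‖ ^ 2 * Real.exp (-(2 * k * -r))) / 2 := by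
    rw [← Finset.sum_add_distrib, Finset.sum_div]
    refine Finset.sum_congr rfl fun k _ => ?_
    rw [e1]; ring
  rw [e2, e3]
  linarith

/-- Multiplication by a function with a bounded analytic extension to the strip is bounded on the
Hardy spaces, including the one of the whole strip. -/
lemma HardyBound.mulL2 {ζ B r b : ℝ} {H : ℂ → ℂ} {u : C(Torus, ℂ)} {ψ : TorusL2}
    (h : HardyBound r ψ b) (hH : DifferentiableOn ℂ H (openStrip ζ))
    (hper : ∀ z ∈ openStrip ζ, H (z + 2 * π) = H z) (hB : ∀ z ∈ openStrip ζ, ‖H z‖ ≤ B)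
    (hu : ∀ x : ℝ, H x = u (x : Torus))
    (hr : 0 ≤ r) (hrζ : r ≤ ζ) (hζ : 0 < ζ) : HardyBound r (mulL2 u ψ) (B * b) := by
  -- trigonometric polynomials
  have h1 : ∀ (F : Finset ℤ) (c : ℤ → ℂ) (F' : Finset ℤ), ∑ k ∈ F', Real.cosh (2 * k * r) *
      ‖fourierCoeff (EDMD.mulL2 u (EDMD.trigSum F c)) k‖ ^ 2 ≤
        B ^ 2 * ∑ k ∈ F, Real.cosh (2 * k * r) * ‖c k‖ ^ 2 := by
    intro F c F'
    have h2 : ∀ k, fourierCoeff (EDMD.mulL2 u (EDMD.trigSum F c)) k = (2 * π : ℂ)⁻¹ *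
        ∫ x in (0 : ℝ)..2 * π, exp (-(k * x * I)) * (H x * trigFun F c x) := by
      intro k
      rw [← toLp_trigC, mulL2_toLp, fourierCoeff_congr_ae (MemLp.coeFn_toLp _), fourierCoeff,
        integral_haar_eq]
      congr 1
      refine intervalIntegral.integral_congr fun x _ => ?_
      rw [fourier_coe_apply, smul_eq_mul, trigC_coe, hu]
      congr 2
      push_cast
      field_simp
    simp only [h2]
    -- For fixed finite sums both sides are continuous in `r`, so the inequality reaches the
    -- endpoint `r = ζ`.
    have hcl : IsClosed {r : ℝ | ∑ k ∈ F', Real.cosh (2 * k * r) *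
        ‖(2 * π : ℂ)⁻¹ * ∫ x in (0 : ℝ)..2 * π, exp (-(k * x * I)) * (H x * trigFun F c x)‖ ^ 2 ≤
          B ^ 2 * ∑ k ∈ F, Real.cosh (2 * k * r) * ‖c k‖ ^ 2} := by
      refine isClosed_le ?_ ?_
      · exact continuous_finsetSum _ fun k _ =>
          (Real.continuous_cosh.comp (by fun_prop)).mul continuous_const
      · exact continuous_const.mul (continuous_finsetSum _ fun k _ =>
          (Real.continuous_cosh.comp (by fun_prop)).mul continuous_const)
    have hsub : Set.Ico 0 ζ ⊆ {r : ℝ | ∑ k ∈ F', Real.cosh (2 * k * r) *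
        ‖(2 * π : ℂ)⁻¹ * ∫ x in (0 : ℝ)..2 * π, exp (-(k * x * I)) * (H x * trigFun F c x)‖ ^ 2 ≤
          B ^ 2 * ∑ k ∈ F, Real.cosh (2 * k * r) * ‖c k‖ ^ 2} := fun r hr =>
      sum_cosh_mul_trigFun_le hH hper hB hr.1 hr.2 F c F'
    have h3 := hcl.closure_subset_iff.2 hsub
    rw [closure_Ico hζ.ne] at h3
    exact h3 ⟨hr, hrζ⟩
  intro F'
  have h2 : Filter.Tendsto (fun F => ∑ k ∈ F', Real.cosh (2 * k * r) *
      ‖fourierCoeff (EDMD.mulL2 u (EDMD.trigSum F (fourierCoeff ψ))) k‖ ^ 2) Filter.atTop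
      (nhds (∑ k ∈ F', Real.cosh (2 * k * r) * ‖fourierCoeff (EDMD.mulL2 u ψ) k‖ ^ 2)) := by
    refine tendsto_finsetSum _ fun k _ => Filter.Tendsto.const_mul _ (Filter.Tendsto.pow ?_ 2)
    refine Filter.Tendsto.norm ?_
    simp only [← inner_fourierLp]
    exact tendsto_const_nhds.inner
      (((EDMD.mulL2 u).continuous.tendsto ψ).comp (tendsto_trigSum ψ))
  refine le_of_tendsto h2 (Filter.Eventually.of_forall fun F => (h1 F _ F').trans ?_)
  rw [mul_pow]
  exact mul_le_mul_of_nonneg_left (h F) (sq_nonneg _)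

/-! ### The projection onto trigonometric polynomials -/

/-- A real continuous function on the torus, as a complex one. -/
noncomputable def complexify (h : C(Torus, ℝ)) : C(Torus, ℂ) :=
  ⟨fun θ => (h θ : ℂ), Complex.continuous_ofReal.comp h.continuous⟩

lemma samplingMeasure_le (h : C(Torus, ℝ)) :
    samplingMeasure h ≤ ENNReal.ofReal (2 * π * ‖h‖) •
      (AddCircle.haarAddCircle : Measure Torus) := by
  rw [mul_comm (2 * π) ‖h‖, ENNReal.ofReal_mul (norm_nonneg _), mul_smul,
    ← AddCircle.volume_eq_smul_haarAddCircle, ← withDensity_const, samplingMeasure]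
  exact withDensity_mono (Filter.Eventually.of_forall fun θ =>
    ENNReal.ofReal_le_ofReal ((le_abs_self _).trans (h.norm_coe_le_norm θ)))

lemma haar_absolutelyContinuous {h : C(Torus, ℝ)} (hpos : ∀ θ, 0 < h θ) :
    (AddCircle.haarAddCircle : Measure Torus) ≪ samplingMeasure h := by
  have h1 : (AddCircle.haarAddCircle : Measure Torus) ≪ (volume : Measure Torus) := by
    rw [AddCircle.volume_eq_smul_haarAddCircle]
    exact Measure.absolutelyContinuous_smul (by simp [Real.pi_pos])
  refine h1.trans (withDensity_absolutelyContinuous' ?_ ?_)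
  · exact (ENNReal.measurable_ofReal.comp h.continuous.measurable).aemeasurable
  · exact Filter.Eventually.of_forall fun θ => by simpa using hpos θ

lemma integral_samplingMeasure {h : C(Torus, ℝ)} (hpos : ∀ θ, 0 < h θ) (q : Torus → ℂ) :
    ∫ θ, q θ ∂samplingMeasure h = 2 * π * ∫ θ, (h θ : ℂ) * q θ ∂AddCircle.haarAddCircle := by
  have hmeas : Measurable fun θ => ENNReal.ofReal (h θ) :=
    ENNReal.measurable_ofReal.comp h.continuous.measurable
  rw [samplingMeasure, integral_withDensity_eq_integral_toReal_smul hmeas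
    (Filter.Eventually.of_forall fun _ => ENNReal.ofReal_lt_top),
    AddCircle.integral_haarAddCircle, Complex.real_smul, ← mul_assoc]
  have : (2 * π : ℂ) * (((2 * π)⁻¹ : ℝ) : ℂ) = 1 := by
    have : (π : ℂ) ≠ 0 := ofReal_ne_zero.2 Real.pi_ne_zero
    push_cast
    field_simp
  rw [this, one_mul]
  refine integral_congr_ae (Filter.Eventually.of_forall fun θ => ?_)
  simp only [ENNReal.toReal_ofReal (hpos θ).le, Complex.real_smul]

lemma mem_trigPoly_iff (μ : Measure Torus) [IsFiniteMeasure μ] (K : ℕ) (x : Lp ℂ 2 μ) :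
    x ∈ trigPoly μ K ↔ ∃ c : ℤ → ℂ,
      (memLp_of_continuous (trigC (Finset.Ioo (-(K : ℤ)) K) c) μ).toLp _ = x := by
  have h1 : {k : ℤ | |k| < (K : ℤ)} = ↑(Finset.Ioo (-(K : ℤ)) K) := by
    ext k; simp [abs_lt]
  have h2 : ∀ c : ℤ → ℂ, (memLp_of_continuous (trigC (Finset.Ioo (-(K : ℤ)) K) c) μ).toLp _ =
      ∑ k ∈ Finset.Ioo (-(K : ℤ)) K, c k • ContinuousMap.toLp (E := ℂ) 2 μ ℂ (fourier k) := by
    intro c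
    have h3 : (memLp_of_continuous (trigC (Finset.Ioo (-(K : ℤ)) K) c) μ).toLp _ =
      ContinuousMap.toLp (E := ℂ) 2 μ ℂ (trigC (Finset.Ioo (-(K : ℤ)) K) c) := rfl
    rw [h3, trigC, map_sum]
    exact Finset.sum_congr rfl fun k _ => map_smul _ _ _
  simp only [h2]
  rw [trigPoly, h1, Submodule.mem_span_image_finset_iff_exists_fun]
  constructor
  · rintro ⟨c, hc⟩
    refine ⟨fun k => if hk : k ∈ Finset.Ioo (-(K : ℤ)) K then c ⟨k, hk⟩ else 0, ?_⟩
    rw [← hc, ← Finset.sum_coe_sort]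
    refine Finset.sum_congr rfl fun k _ => ?_
    exact congrArg (· • _) (dif_pos k.2)
  · rintro ⟨c, hc⟩
    refine ⟨fun k => c k, hc ▸ ?_⟩
    exact Finset.sum_coe_sort _ fun k => c k • ContinuousMap.toLp (E := ℂ) 2 μ ℂ (fourier k)

/-- The weighted projection in terms of `L²` of the normalised Lebesgue measure. -/
lemma exists_trigProj_eq {h : C(Torus, ℝ)} (hpos : ∀ θ, 0 < h θ) (K : ℕ) {φ : Torus → ℂ}
    (hφ : MemLp φ 2 (AddCircle.haarAddCircle : Measure Torus)) :
    ∃ c : ℤ → ℂ, trigProj (samplingMeasure h) K φ =ᵐ[AddCircle.haarAddCircle]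
        trigC (Finset.Ioo (-(K : ℤ)) K) c ∧
      ∀ c', inner ℂ (mulL2 (complexify h) (hφ.toLp φ - trigSum (Finset.Ioo (-(K : ℤ)) K) c))
        (trigSum (Finset.Ioo (-(K : ℤ)) K) c') = 0 := by
  have hφμ : MemLp φ 2 (samplingMeasure h) :=
    hφ.of_measure_le_smul ENNReal.ofReal_ne_top (samplingMeasure_le h)
  set μ := samplingMeasure h
  set S := Finset.Ioo (-(K : ℤ)) K
  obtain ⟨c, hc⟩ := (mem_trigPoly_iff μ K _).1
    ((trigPoly μ K).starProjection_apply_mem (hφμ.toLp φ))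
  have h1 : trigProj μ K φ = ⇑((trigPoly μ K).starProjection (hφμ.toLp φ)) := by
    rw [trigProj, dif_pos hφμ]
  refine ⟨c, ?_, fun c' => ?_⟩
  · refine (haar_absolutelyContinuous hpos).ae_eq ?_
    rw [h1, ← hc]
    exact MemLp.coeFn_toLp _
  · have h2 := (trigPoly μ K).starProjection_inner_eq_zero (hφμ.toLp φ) _
      ((mem_trigPoly_iff μ K _).2 ⟨c', rfl⟩)
    rw [← hc, ← MemLp.toLp_sub, L2.inner_def] at h2
    have h3 : ∫ θ, conj (φ θ - trigC S c θ) * trigC S c' θ ∂μ = 0 := by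
      rw [← h2]
      refine integral_congr_ae ?_
      filter_upwards [MemLp.coeFn_toLp (hφμ.sub (memLp_of_continuous (trigC S c) μ)),
        MemLp.coeFn_toLp (memLp_of_continuous (trigC S c') μ)] with θ hθ1 hθ2
      rw [hθ1, hθ2, RCLike.inner_apply, mul_comm]
      rfl
    rw [integral_samplingMeasure hpos, mul_eq_zero] at h3
    have h4 := h3.resolve_left (by simp [Real.pi_ne_zero])
    rw [← toLp_trigC, ← toLp_trigC, ← MemLp.toLp_sub, mulL2_toLp, L2.inner_def, ← h4]
    refine integral_congr_ae ?_
    filter_upwards [MemLp.coeFn_toLp (memLp_continuous_mul (complexify h)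
      (hφ.sub (memLp_of_continuous (trigC S c) AddCircle.haarAddCircle))),
      MemLp.coeFn_toLp (memLp_of_continuous (trigC S c') AddCircle.haarAddCircle)] with θ hθ1 hθ2
    rw [hθ1, hθ2, RCLike.inner_apply, map_mul]
    simp only [complexify, ContinuousMap.coe_mk, conj_ofReal, Pi.sub_apply]
    ring

/-- Multiplication by a real function is self-adjoint. -/
lemma inner_mulL2_left (h : C(Torus, ℝ)) (φ ψ : TorusL2) :
    inner ℂ (mulL2 (complexify h) φ) ψ = inner ℂ φ (mulL2 (complexify h) ψ) := by
  rw [L2.inner_def, L2.inner_def]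
  refine integral_congr_ae ?_
  filter_upwards [coeFn_mulL2 (complexify h) φ, coeFn_mulL2 (complexify h) ψ] with θ h1 h2
  rw [h1, h2, RCLike.inner_apply, RCLike.inner_apply, map_mul]
  simp only [complexify, ContinuousMap.coe_mk, conj_ofReal]
  ring

lemma mulL2_mulL2 {u w : C(Torus, ℂ)} (huw : ∀ θ, u θ * w θ = 1) (ψ : TorusL2) :
    mulL2 u (mulL2 w ψ) = ψ := by
  refine Lp.ext ?_
  filter_upwards [coeFn_mulL2 u (mulL2 w ψ), coeFn_mulL2 w ψ] with θ h1 h2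
  rw [h1, h2, ← mul_assoc, huw, one_mul]

/-- Coercivity of the weighted form; it yields both the uniqueness of the projection and its `L²`
bound. -/
lemma le_inner_mulL2 {h : C(Torus, ℝ)} {m : ℝ} (hm : ∀ θ, m ≤ h θ) (ψ : TorusL2) :
    m * ‖ψ‖ ^ 2 ≤ (inner ℂ (mulL2 (complexify h) ψ) ψ).re := by
  have h1 : inner ℂ (mulL2 (complexify h) ψ) ψ =
      ((∫ θ, h θ * ‖ψ θ‖ ^ 2 ∂AddCircle.haarAddCircle : ℝ) : ℂ) := by
    rw [L2.inner_def, ← integral_complex_ofReal]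
    refine integral_congr_ae ?_
    filter_upwards [coeFn_mulL2 (complexify h) ψ] with θ h1
    rw [h1, RCLike.inner_apply, map_mul]
    simp only [complexify, ContinuousMap.coe_mk, conj_ofReal]
    push_cast
    rw [← Complex.mul_conj']
    ring
  have h2 : ‖ψ‖ ^ 2 = ∫ θ, ‖ψ θ‖ ^ 2 ∂(AddCircle.haarAddCircle : Measure Torus) :=
    (hasSum_norm_sq ψ).unique (hasSum_sq_fourierCoeff ψ)
  have hi : Integrable (fun θ => ‖ψ θ‖ ^ 2) (AddCircle.haarAddCircle : Measure Torus) :=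
    (Lp.memLp ψ).integrable_norm_pow (by norm_num)
  rw [h1, ofReal_re, h2, ← integral_const_mul]
  refine integral_mono (hi.const_mul m) ?_ fun θ => mul_le_mul_of_nonneg_right (hm θ) (sq_nonneg _)
  refine hi.bdd_mul (c := ‖h‖) h.continuous.aestronglyMeasurable ?_
  exact Filter.Eventually.of_forall h.norm_coe_le_norm

/-- The coefficients of the weighted projection define a linear map. -/
lemma exists_projection {h : C(Torus, ℝ)} {m : ℝ} (hm0 : 0 < m) (hm : ∀ θ, m ≤ h θ) (K : ℕ) :
    ∃ P : TorusL2 →ₗ[ℂ] TorusL2,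
      (∀ (φ : Torus → ℂ) (hφ : MemLp φ 2 (AddCircle.haarAddCircle : Measure Torus)),
        ∃ hT : MemLp (trigProj (samplingMeasure h) K φ) 2 (AddCircle.haarAddCircle : Measure Torus),
          P (hφ.toLp φ) = hT.toLp (trigProj (samplingMeasure h) K φ)) ∧
      (∀ φ, ∃ c, P φ = trigSum (Finset.Ioo (-(K : ℤ)) K) c) ∧
      (∀ φ c', inner ℂ (mulL2 (complexify h) (φ - P φ)) (trigSum (Finset.Ioo (-(K : ℤ)) K) c') = 0) ∧
      ∀ c, P (trigSum (Finset.Ioo (-(K : ℤ)) K) c) = trigSum (Finset.Ioo (-(K : ℤ)) K) c := by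
  set S := Finset.Ioo (-(K : ℤ)) K
  have hpos : ∀ θ, 0 < h θ := fun θ => hm0.trans_le (hm θ)
  have hadd : ∀ c c', trigSum S c + trigSum S c' = trigSum S (c + c') := fun c c' => by
    simp only [trigSum, ← Finset.sum_add_distrib, Pi.add_apply, add_smul]
  have hsmul : ∀ (a : ℂ) c, a • trigSum S c = trigSum S (a • c) := fun a c => by
    simp only [trigSum, Finset.smul_sum, Pi.smul_apply, smul_smul, smul_eq_mul]
  have hsub : ∀ c c', trigSum S c - trigSum S c' = trigSum S (c - c') := fun c c' => by
    simp only [trigSum, ← Finset.sum_sub_distrib, Pi.sub_apply, sub_smul]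
  have hex : ∀ φ : TorusL2, ∃ c, trigProj (samplingMeasure h) K φ =ᵐ[AddCircle.haarAddCircle]
      trigC S c ∧ ∀ c', inner ℂ (mulL2 (complexify h) (φ - trigSum S c)) (trigSum S c') = 0 := by
    intro φ
    have := exists_trigProj_eq hpos K (Lp.memLp φ)
    simpa only [Lp.toLp_coeFn] using this
  choose c hc1 hc2 using hex
  -- The orthogonality relations determine the polynomial: a difference of two solutions is
  -- orthogonal to itself in the weighted form. Linearity of `P` follows from this uniqueness.
  have huniq : ∀ (φ : TorusL2) (d : ℤ → ℂ),
      (∀ c', inner ℂ (mulL2 (complexify h) (φ - trigSum S d)) (trigSum S c') = 0) →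
        trigSum S (c φ) = trigSum S d := by
    intro φ d hd
    have h1 : ∀ c', inner ℂ (mulL2 (complexify h) (trigSum S (c φ) - trigSum S d))
        (trigSum S c') = 0 := by
      intro c'
      have h2 : trigSum S (c φ) - trigSum S d =
          (φ - trigSum S d) - (φ - trigSum S (c φ)) := by abel
      rw [h2, map_sub, inner_sub_left, hd, hc2, sub_zero]
    have h2 := le_inner_mulL2 hm (trigSum S (c φ) - trigSum S d)
    have h5 := h1 (c φ - d)
    rw [← hsub] at h5
    rw [h5, zero_re] at h2
    have h3 : ‖trigSum S (c φ) - trigSum S d‖ = 0 := by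
      by_contra h3
      have h4 : 0 < ‖trigSum S (c φ) - trigSum S d‖ := lt_of_le_of_ne (norm_nonneg _) (Ne.symm h3)
      have : 0 < m * ‖trigSum S (c φ) - trigSum S d‖ ^ 2 := by positivity
      linarith
    exact sub_eq_zero.1 (norm_eq_zero.1 h3)
  let P : TorusL2 →ₗ[ℂ] TorusL2 :=
    { toFun := fun φ => trigSum S (c φ)
      map_add' := fun φ ψ => by
        rw [hadd]
        refine huniq _ _ fun c' => ?_
        rw [← hadd, add_sub_add_comm, map_add, inner_add_left, hc2, hc2, add_zero]
      map_smul' := fun a φ => by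
        rw [RingHom.id_apply, hsmul]
        refine huniq _ _ fun c' => ?_
        rw [← hsmul, ← smul_sub, map_smul, inner_smul_left, hc2, mul_zero] }
  refine ⟨P, fun φ hφ => ?_, fun φ => ⟨c φ, rfl⟩, fun φ c' => hc2 φ c', fun d => ?_⟩
  · obtain ⟨d, hd1, hd2⟩ := exists_trigProj_eq hpos K hφ
    have hT := (memLp_congr_ae hd1).2 (memLp_of_continuous (trigC S d) AddCircle.haarAddCircle)
    refine ⟨hT, ?_⟩
    change trigSum S (c (hφ.toLp φ)) = _
    rw [huniq _ d hd2, ← toLp_trigC]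
    exact (MemLp.toLp_congr _ _ hd1).symm
  · refine huniq _ d fun c' => ?_
    rw [sub_self, map_zero, inner_zero_left]

/-- The norm bound for the complementary projections, in terms of the bounds on the density. -/
noncomputable def projConst (M : ℝ) : ℝ := 2 * (M ^ 2 + M ^ 4)

lemma projConst_nonneg (M : ℝ) : 0 ≤ projConst M := by
  unfold projConst
  positivity

lemma cosh_two_mul_le (k : ℤ) {r : ℝ} (hr : 0 ≤ r) :
    Real.cosh (2 * k * r) ≤ Real.exp (2 * |(k : ℝ)| * r) := by
  have h1 : 2 * |(k : ℝ)| * r = |2 * k * r| := by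
    rw [abs_mul, abs_mul, abs_two, abs_of_nonneg hr]
  rw [h1, ← Real.cosh_abs, Real.cosh_eq]
  have : Real.exp (-|2 * k * r|) ≤ Real.exp |2 * k * r| :=
    Real.exp_le_exp.2 (by linarith [abs_nonneg (2 * (k : ℝ) * r)])
  linarith

lemma exp_le_two_mul_cosh (k : ℤ) {r : ℝ} (hr : 0 ≤ r) :
    Real.exp (2 * |(k : ℝ)| * r) ≤ 2 * Real.cosh (2 * k * r) := by
  have h1 : 2 * |(k : ℝ)| * r = |2 * k * r| := by
    rw [abs_mul, abs_mul, abs_two, abs_of_nonneg hr]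
  rw [h1, ← Real.cosh_abs (2 * k * r), Real.cosh_eq]
  linarith [Real.exp_pos (-|2 * k * r|)]

/-- An inverse inequality for trigonometric polynomials. -/
lemma hardyBound_trigSum_Ioo (K : ℕ) (c : ℤ → ℂ) {r : ℝ} (hr : 0 ≤ r) :
    HardyBound r (trigSum (Finset.Ioo (-(K : ℤ)) K) c)
      (Real.exp (r * K) * ‖trigSum (Finset.Ioo (-(K : ℤ)) K) c‖) := by
  refine hardyBound_trigSum ?_
  rw [mul_pow, ← (hasSum_norm_sq _).tsum_eq, tsum_eq_sum (s := Finset.Ioo (-(K : ℤ)) K)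
    (fun k hk => by rw [fourierCoeff_trigSum, if_neg hk]; simp), Finset.mul_sum]
  refine Finset.sum_le_sum fun k hk => ?_
  rw [fourierCoeff_trigSum, if_pos hk]
  refine mul_le_mul_of_nonneg_right ((cosh_two_mul_le k hr).trans ?_) (sq_nonneg _)
  rw [← Real.exp_nat_mul, Real.exp_le_exp]
  have h1 : |(k : ℝ)| ≤ K := by
    have := Finset.mem_Ioo.1 hk
    rw [abs_le]
    exact ⟨by exact_mod_cast this.1.le, by exact_mod_cast this.2.le⟩
  push_cast
  nlinarith

/-- The tail of a Fourier series in weaker Hardy norms. -/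
lemma HardyBound.tail {s t b : ℝ} {g : TorusL2} (h : HardyBound t g b) (hs : 0 ≤ s) (hst : s ≤ t)
    (K : ℕ) : HardyBound s (g - EDMD.trigSum (Finset.Ioo (-(K : ℤ)) K) (fourierCoeff g))
      (2 * Real.exp (-((t - s) * K)) * b) := by
  intro F
  rw [mul_pow]
  refine le_trans ?_ (mul_le_mul_of_nonneg_left (h F) (sq_nonneg _))
  rw [Finset.mul_sum]
  refine Finset.sum_le_sum fun k _ => ?_
  rw [fourierCoeff_sub_L2, fourierCoeff_trigSum]
  split_ifs with hk
  · rw [sub_self, norm_zero]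
    have := Real.cosh_pos (2 * k * t)
    simp only [ne_eq, OfNat.ofNat_ne_zero, not_false_eq_true, zero_pow, mul_zero]
    positivity
  · rw [sub_zero, ← mul_assoc]
    refine mul_le_mul_of_nonneg_right ?_ (sq_nonneg _)
    have h1 : (K : ℝ) ≤ |(k : ℝ)| := by
      by_contra h1
      rw [not_le, abs_lt] at h1
      exact hk (Finset.mem_Ioo.2 ⟨by exact_mod_cast h1.1, by exact_mod_cast h1.2⟩)
    have h2 := exp_le_two_mul_cosh k (hs.trans hst)
    -- Outside the truncation `|k| ≥ K`, so `|k|(t - s) ≥ K(t - s)`.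
    have h3 : Real.exp (2 * |(k : ℝ)| * s) ≤
        Real.exp (-((t - s) * K)) ^ 2 * Real.exp (2 * |(k : ℝ)| * t) := by
      rw [← Real.exp_nat_mul, ← Real.exp_add, Real.exp_le_exp]
      push_cast
      nlinarith [mul_le_mul_of_nonneg_left h1 (sub_nonneg.2 hst)]
    calc _ ≤ _ := cosh_two_mul_le k hs
      _ ≤ Real.exp (-((t - s) * K)) ^ 2 * (2 * Real.cosh (2 * k * t)) :=
        h3.trans (mul_le_mul_of_nonneg_left h2 (sq_nonneg _))
      _ ≤ _ := by
        have := Real.cosh_pos (2 * k * t)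
        nlinarith [mul_nonneg (sq_nonneg (Real.exp (-((t - s) * K)))) this.le]

section

variable {h : C(Torus, ℝ)} {ζ M : ℝ} {A : ℝ≥0} {q : ℝ≥0∞}

lemma IsAnalyticDensity.bounds (hζ : 0 < ζ) (hh : IsAnalyticDensity h ζ M A q) :
    0 < M ∧ ∀ θ, M⁻¹ ≤ h θ ∧ h θ ≤ M := by
  obtain ⟨H, -, -, hH, hb⟩ := hh.exists_extension
  have h1 : ∀ θ, M⁻¹ ≤ h θ ∧ h θ ≤ M := by
    intro θ
    induction θ using QuotientAddGroup.induction_on with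
    | H x =>
      have h2 := hb x (by simpa [openStrip] using hζ)
      rw [hH, Complex.norm_real, Real.norm_eq_abs, abs_of_pos (hh.pos _)] at h2
      exact h2
  exact ⟨(hh.pos 0).trans_le (h1 0).2, h1⟩

/-- The complementary projection from `H²_{-s}` to `H²_{-t}`. -/
lemma IsAnalyticDensity.dualNorm_projection_sub_le (hζ : 0 < ζ) (hh : IsAnalyticDensity h ζ M A q)
    {K : ℕ} {P : TorusL2 →ₗ[ℂ] TorusL2}
    (hP1 : ∀ φ, ∃ c, P φ = trigSum (Finset.Ioo (-(K : ℤ)) K) c)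
    (hP2 : ∀ φ c', inner ℂ (mulL2 (complexify h) (φ - P φ))
      (trigSum (Finset.Ioo (-(K : ℤ)) K) c') = 0)
    (hP3 : ∀ c, P (trigSum (Finset.Ioo (-(K : ℤ)) K) c) = trigSum (Finset.Ioo (-(K : ℤ)) K) c)
    {s t : ℝ} (hs : 0 ≤ s) (hst : s ≤ t) (htζ : t ≤ ζ) (φ : TorusL2) :
    dualNorm t (P φ - φ) ≤ projConst M * Real.exp (-((t - s) * K)) * dualNorm s φ := by
  obtain ⟨hM, hhM⟩ := hh.bounds hζ
  obtain ⟨H, hHd, hHper, hHreal, hHb⟩ := hh.exists_extension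
  set S := Finset.Ioo (-(K : ℤ)) K
  set T := mulL2 (complexify h) with hT
  have ht : 0 ≤ t := hs.trans hst
  -- the inverse of the density
  let w : C(Torus, ℂ) := ⟨fun θ => (complexify h θ)⁻¹, by
    refine (complexify h).continuous.inv₀ fun θ => ?_
    simpa [complexify] using (hh.pos θ).ne'⟩
  have hw : ∀ θ, complexify h θ * w θ = 1 := fun θ => by
    refine mul_inv_cancel₀ ?_
    simpa [complexify] using (hh.pos θ).ne'
  have hwMul : ∀ {r b : ℝ} {ψ : TorusL2}, HardyBound r ψ b → 0 ≤ r → r ≤ ζ →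
      HardyBound r (mulL2 w ψ) (M * b) := by
    intro r b ψ hψ hr hrζ
    refine hψ.mulL2 (H := fun z => (H z)⁻¹) ?_ ?_ ?_ ?_ hr hrζ hζ
    · refine hHd.inv fun z hz => ?_
      have := (inv_pos.2 hM).trans_le (hHb z hz).1
      exact norm_pos_iff.1 this
    · exact fun z _ => by rw [hHper]
    · intro z hz
      rw [norm_inv]
      exact inv_le_of_inv_le₀ hM (hHb z hz).1
    · exact fun x => by rw [hHreal]; rfl
  have hhMul : ∀ {r b : ℝ} {ψ : TorusL2}, HardyBound r ψ b → 0 ≤ r → r ≤ ζ →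
      HardyBound r (T ψ) (M * b) := fun hψ hr hrζ =>
    hψ.mulL2 hHd (fun z _ => hHper z) (fun z hz => (hHb z hz).2) hHreal hr hrζ hζ
  -- Orthogonality gives `⟨h Pρ, Pρ⟩ = ⟨hρ, Pρ⟩`; the bounds `M⁻¹ ≤ h ≤ M` contribute one factor `M`
  -- each.
  have hPnorm : ∀ ρ, ‖P ρ‖ ≤ M ^ 2 * ‖ρ‖ := by
    intro ρ
    obtain ⟨c, hc⟩ := hP1 ρ
    have h1 := hP2 ρ c
    rw [← hc, map_sub, inner_sub_left, sub_eq_zero] at h1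
    have h2 := le_inner_mulL2 (fun θ => (hhM θ).1) (P ρ)
    rw [← hT, ← h1] at h2
    have h3 : ‖T ρ‖ ≤ M * ‖ρ‖ := norm_mulL2_le (fun θ => by
      simpa [complexify, abs_of_pos (hh.pos θ)] using (hhM θ).2) ρ
    have h4 := (Complex.re_le_norm _).trans (norm_inner_le_norm (𝕜 := ℂ) (T ρ) (P ρ))
    have h5 : M⁻¹ * ‖P ρ‖ ^ 2 ≤ M * ‖ρ‖ * ‖P ρ‖ :=
      h2.trans (h4.trans (mul_le_mul_of_nonneg_right h3 (norm_nonneg _)))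
    rw [inv_mul_le_iff₀ hM] at h5
    rcases (norm_nonneg (P ρ)).eq_or_lt with h6 | h6
    · rw [← h6]; positivity
    · nlinarith
  refine dualNorm_le (mul_nonneg (mul_nonneg (projConst_nonneg M) (Real.exp_pos _).le)
    (apply_nonneg _ _)) fun ψ hψ => ?_
  -- With `ψ = h g`, the pairing with `ψ` is a pairing with `g` in `L²(μ)`, up to normalisation.
  set g := mulL2 w ψ with hg
  have hTg : T g = ψ := mulL2_mulL2 hw ψ
  have hgb : HardyBound t g M := by simpa using hwMul hψ ht htζ
  set ρ := g - trigSum S (fourierCoeff g) with hρ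
  -- As `P` fixes the low modes, only the tail `ρ` of `g` contributes.
  have hgP : g - P g = ρ - P ρ := by
    rw [hρ, map_sub, hP3]; abel
  obtain ⟨cg, hcg⟩ := hP1 g
  obtain ⟨cφ, hcφ⟩ := hP1 φ
  -- Self-adjointness of `P` in `L²(μ)`, in the form of two vanishing cross terms.
  have e1 : inner ℂ (P φ - φ) ψ = -inner ℂ φ (T (g - P g)) := by
    have h1 : inner ℂ (P φ - φ) (T (P g)) = 0 := by
      rw [← inner_mulL2_left, ← neg_sub, map_neg, inner_neg_left, hcg, hP2, neg_zero]
    have h2 : inner ℂ (P φ) (T (g - P g)) = 0 := by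
      rw [← inner_conj_symm, hcφ, hP2, map_zero]
    calc inner ℂ (P φ - φ) ψ = inner ℂ (P φ - φ) (T (g - P g)) := by
          rw [map_sub, inner_sub_right, h1, sub_zero, hTg]
      _ = _ := by rw [inner_sub_left, h2, zero_sub]
  set e := Real.exp (-((t - s) * K)) with he
  have he0 : 0 < e := Real.exp_pos _
  have hρs : HardyBound s (T ρ) (M * (2 * e * M)) := hhMul (hgb.tail hs hst K) hs (hst.trans htζ)
  have hρ0 : ‖ρ‖ ≤ 2 * Real.exp (-(t * K)) * M := by
    have := (hgb.tail le_rfl ht K).norm_le (by positivity)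
    rwa [sub_zero] at this
  have hPρ : HardyBound s (T (P ρ)) (M * (Real.exp (s * K) * ‖P ρ‖)) := by
    obtain ⟨c, hc⟩ := hP1 ρ
    refine hhMul ?_ hs (hst.trans htζ)
    rw [hc]
    exact hardyBound_trigSum_Ioo K c hs
  have h1 := hρs.norm_inner_le (by positivity) φ
  have h2 := hPρ.norm_inner_le (by positivity) φ
  -- The inverse inequality costs `exp(sK)` and the `L²` norm of the tail gains `exp(-tK)`.
  have h3 : Real.exp (s * K) * ‖P ρ‖ ≤ 2 * M ^ 3 * e := by
    calc _ ≤ Real.exp (s * K) * (M ^ 2 * (2 * Real.exp (-(t * K)) * M)) :=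
          mul_le_mul_of_nonneg_left ((hPnorm ρ).trans
            (mul_le_mul_of_nonneg_left hρ0 (sq_nonneg _))) (Real.exp_pos _).le
      _ = 2 * M ^ 3 * (Real.exp (s * K) * Real.exp (-(t * K))) := by ring
      _ = _ := by
        rw [← Real.exp_add, he]
        congr 2
        ring
  have h4 : 0 ≤ dualNorm s φ := apply_nonneg _ _
  rw [e1, norm_neg, hgP, map_sub, inner_sub_right]
  calc _ ≤ M * (2 * e * M) * dualNorm s φ + M * (Real.exp (s * K) * ‖P ρ‖) * dualNorm s φ :=
        (norm_sub_le _ _).trans (add_le_add h1 h2)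
    _ ≤ M * (2 * e * M) * dualNorm s φ + M * (2 * M ^ 3 * e) * dualNorm s φ := by gcongr
    _ = _ := by rw [projConst]; ring

/-! ### Compactness -/

/-- The inclusion of `L²` in `H²_{-t}` as a linear map. -/
noncomputable def toHyperₗ (t : ℝ) : TorusL2 →ₗ[ℂ] Hyper t where
  toFun := toHyper t
  map_add' φ ψ := UniformSpace.Completion.coe_add (α := PreHyper t) φ ψ
  map_smul' c φ := UniformSpace.Completion.coe_smul (X := PreHyper t) c φ

/-- A bounded operator that maps `L²` to trigonometric polynomials of bounded degree is compact. -/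
lemma isCompactOperator_of_trigSum {t : ℝ} {B : Hyper t →L[ℂ] Hyper t} (S : Finset ℤ)
    (hB : ∀ φ, ∃ c, B (toHyper t φ) = toHyper t (trigSum S c)) : IsCompactOperator B := by
  let E : Submodule ℂ TorusL2 := Submodule.span ℂ ((fun k : ℤ => (fourierLp 2 k : TorusL2)) '' S)
  have : FiniteDimensional ℂ E :=
    FiniteDimensional.span_of_finite ℂ (S.finite_toSet.image _)
  let V : Submodule ℂ (Hyper t) := E.map (toHyperₗ t)
  have hVfin : FiniteDimensional ℂ V := inferInstance
  have hmem : ∀ x, B x ∈ V := by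
    intro x
    -- A finite-dimensional `V` is closed, so it contains the whole range once it contains the image
    -- of a dense set.
    refine (denseRange_toHyper t).induction_on (p := fun x => B x ∈ V) x
      (V.closed_of_finiteDimensional.preimage B.continuous) fun φ => ?_
    obtain ⟨c, hc⟩ := hB φ
    rw [hc]
    refine Submodule.mem_map_of_mem (f := toHyperₗ t) (Submodule.sum_mem _ fun k hk => ?_)
    exact Submodule.smul_mem _ _ (Submodule.subset_span ⟨k, hk, rfl⟩)
  have : ProperSpace V := FiniteDimensional.proper ℂ V
  have h1 : IsCompactOperator (B.codRestrict V hmem) :=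
    isCompactOperator_of_locallyCompactSpace_dom (B.codRestrict V hmem)
  exact h1.clm_comp V.subtypeL

end

end EDMD

/-! ### The main theorem -/

open EDMD
theorem theorem3 (M : ℝ) (A D : ℝ≥0) (ζ : ℝ) (hζ : 0 < ζ) :
    ∃ C : ℝ, ∀ (f : Torus → Torus) (h : C(Torus, ℝ)) (κ : ℝ) (α : ℝ≥0) (q : ℝ≥0∞),
      IsExpanding f ζ κ α D → IsAnalyticDensity h ζ M A q →
      ∀ t : ℝ, 0 < t → t ≤ ζ →
        ∃ (𝒦 : Hyper t →L[ℂ] Hyper t) (𝒦' : Hyper (κ * t) →L[ℂ] Hyper (κ * t)),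
          Extends t 𝒦 (koopman f) ∧ Extends (κ * t) 𝒦' (koopman f) ∧
          IsCompactOperator 𝒦 ∧
          ∀ K : ℕ,
            ∃ (P : Hyper t →L[ℂ] Hyper t) (P' : Hyper (κ * t) →L[ℂ] Hyper (κ * t)),
              Extends t P (trigProj (samplingMeasure h) K) ∧
              Extends (κ * t) P' (trigProj (samplingMeasure h) K) ∧
              ‖P ∘L 𝒦 - 𝒦‖ ≤ C * Real.exp (-((1 - κ) * t * K)) ∧
              ‖𝒦' ∘L P' - 𝒦'‖ ≤ C * Real.exp (-((1 - κ) * t * K)) := by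
  -- The constant is the product of the bounds for `P_K - 1` from `H²_{-κt}` to `H²_{-t}` (without
  -- the rate) and for `𝒦` in the other direction.
  refine ⟨projConst M * koopmanConst D, fun f h κ α q hf hh t ht htζ => ?_⟩
  obtain ⟨-, -, -, -, -, -, -, hκ0, -⟩ := hf.exists_inverseLift hζ
  obtain ⟨S, hS⟩ := hf.exists_koopman hζ
  have hSb := hf.dualNorm_koopman_le hζ hS ht htζ
  have hCk := koopmanConst_pos D
  have hCp := projConst_nonneg M
  have hs : 0 ≤ κ * t := (mul_pos hκ0 ht).le
  have hst : κ * t ≤ t := mul_le_of_le_one_left ht.le hf.kappa_lt_one.le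
  obtain ⟨𝒦, h𝒦⟩ := exists_hyper_extension (t := t) (C := koopmanConst D) S.toLinearMap fun φ =>
    (dualNorm_antitone hs hst _).trans (hSb φ)
  obtain ⟨𝒦', h𝒦'⟩ := exists_hyper_extension (t := κ * t) (C := koopmanConst D) S.toLinearMap
    fun φ => (hSb φ).trans (mul_le_mul_of_nonneg_left (dualNorm_antitone hs hst _) hCk.le)
  obtain ⟨hM, hhM⟩ := hh.bounds hζ
  have hproj : ∀ K : ℕ, ∃ (P : Hyper t →L[ℂ] Hyper t) (P' : Hyper (κ * t) →L[ℂ] Hyper (κ * t)),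
      Extends t P (trigProj (samplingMeasure h) K) ∧
      Extends (κ * t) P' (trigProj (samplingMeasure h) K) ∧ IsCompactOperator P ∧
      ‖P ∘L 𝒦 - 𝒦‖ ≤ projConst M * koopmanConst D * Real.exp (-((1 - κ) * t * K)) ∧
      ‖𝒦' ∘L P' - 𝒦'‖ ≤ projConst M * koopmanConst D * Real.exp (-((1 - κ) * t * K)) := by
    intro K
    obtain ⟨P₀, hP0, hP1, hP2, hP3⟩ := exists_projection (inv_pos.2 hM) (fun θ => (hhM θ).1) K
    have hdiff : ∀ {s r : ℝ}, 0 ≤ s → s ≤ r → r ≤ ζ → ∀ φ, dualNorm r (P₀ φ - φ) ≤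
        projConst M * Real.exp (-((r - s) * K)) * dualNorm s φ := fun hs hsr hrζ φ =>
      hh.dualNorm_projection_sub_le hζ hP1 hP2 hP3 hs hsr hrζ φ
    -- The case of equal indices, where the exponential rate is 1.
    have hbdd : ∀ {r : ℝ}, 0 ≤ r → r ≤ ζ → ∀ φ,
        dualNorm r (P₀ φ) ≤ (projConst M + 1) * dualNorm r φ := by
      intro r hr hrζ φ
      have h1 := hdiff hr le_rfl hrζ φ
      rw [sub_self, zero_mul, neg_zero, Real.exp_zero, mul_one] at h1
      have h2 := map_add_le_add (dualNorm r) (P₀ φ - φ) φ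
      rw [sub_add_cancel] at h2
      linarith
    obtain ⟨P, hP⟩ := exists_hyper_extension P₀ (hbdd ht.le htζ)
    obtain ⟨P', hP'⟩ := exists_hyper_extension P₀ (hbdd hs (hst.trans htζ))
    have hrate : t - κ * t = (1 - κ) * t := by ring
    refine ⟨P, P', fun φ hφ => ?_, fun φ hφ => ?_, ?_, ?_, ?_⟩
    · obtain ⟨hT, h1⟩ := hP0 φ hφ
      exact ⟨hT, by rw [hP, h1]⟩
    · obtain ⟨hT, h1⟩ := hP0 φ hφ
      exact ⟨hT, by rw [hP', h1]⟩
    · refine isCompactOperator_of_trigSum (Finset.Ioo (-(K : ℤ)) K) fun φ => ?_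
      obtain ⟨c, hc⟩ := hP1 φ
      exact ⟨c, by rw [hP, hc]⟩
    -- First `𝒦` from `H²_{-t}` to `H²_{-κt}`, then `P - 1` back.
    · refine opNorm_le_of_dualNorm_le (by positivity) (S := fun φ => P₀ (S φ) - S φ)
        (fun φ => ?_) fun φ => ?_
      · rw [toHyper_sub, ← hP, sub_apply, ContinuousLinearMap.comp_apply, h𝒦]
        rfl
      · have h1 := hdiff hs hst htζ (S φ)
        rw [hrate] at h1
        calc _ ≤ _ := h1
          _ ≤ projConst M * Real.exp (-((1 - κ) * t * K)) * (koopmanConst D * dualNorm t φ) :=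
            mul_le_mul_of_nonneg_left (hSb φ) (by positivity)
          _ = _ := by ring
    -- The opposite order: `P - 1` from `H²_{-κt}` to `H²_{-t}`, then `𝒦` back.
    · refine opNorm_le_of_dualNorm_le (by positivity) (S := fun φ => S (P₀ φ - φ))
        (fun φ => ?_) fun φ => ?_
      · rw [map_sub, toHyper_sub, sub_apply, ContinuousLinearMap.comp_apply,
          hP', h𝒦', h𝒦']
        rfl
      · have h1 := hdiff hs hst htζ φ
        rw [hrate] at h1
        calc _ ≤ _ := hSb _
          _ ≤ koopmanConst D * (projConst M * Real.exp (-((1 - κ) * t * K)) *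
              dualNorm (κ * t) φ) := mul_le_mul_of_nonneg_left h1 hCk.le
          _ = _ := by ring
  choose P P' hP hP' hPc hn hn' using hproj
  refine ⟨𝒦, 𝒦', fun φ hφ => ?_, fun φ hφ => ?_, ?_,
    fun K => ⟨P K, P' K, hP K, hP' K, hn K, hn' K⟩⟩
  · obtain ⟨hT, h1⟩ := hS φ hφ
    exact ⟨hT, by rw [h𝒦, ← h1]; rfl⟩
  · obtain ⟨hT, h1⟩ := hS φ hφ
    exact ⟨hT, by rw [h𝒦', ← h1]; rfl⟩
  · have hlim : Filter.Tendsto (fun K : ℕ => P K ∘L 𝒦) Filter.atTop (nhds 𝒦) := by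
      rw [tendsto_iff_norm_sub_tendsto_zero]
      have h1 : 0 < (1 - κ) * t := mul_pos (sub_pos.2 hf.kappa_lt_one) ht
      have h2 : Filter.Tendsto (fun K : ℕ => projConst M * koopmanConst D *
          Real.exp (-((1 - κ) * t * K))) Filter.atTop (nhds 0) := by
        rw [← mul_zero (projConst M * koopmanConst D)]
        refine Filter.Tendsto.const_mul _ (Real.tendsto_exp_neg_atTop_nhds_zero.comp ?_)
        exact tendsto_natCast_atTop_atTop.const_mul_atTop h1
      exact squeeze_zero (fun _ => norm_nonneg _) hn h2
    exact isCompactOperator_of_tendsto hlim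
      (Filter.Eventually.of_forall fun K => (hPc K).comp_clm 𝒦)
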